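/- Let $k$ be a field and let $\pi$ be a multiplicative proof net (the translation of a proof in the one-sided sequent calculus of unit-free multiplicative linear logic with rules ax, cut, $\otimes$, ⅋, exchange) with a single conclusion $A$. Formulas are built from oriented atoms $(X,\pm)$ by $\otimes$ and ⅋, with negation given by $\neg(A\otimes B)=\neg B$ ⅋ $\neg A$, $\neg(A$ ⅋ $B)=\neg B\otimes\neg A$, $\neg(X,\pm)=(X,\mp)$; thus the sequence of atoms of $\neg A$ is that of $A$ reversed with opposite signs. Let $U_\pi$ be the set of atom occurrences of $\pi$, i.e. of pairs of an edge and a position in the sequence of atoms of the formula on this edge. Let $P_\pi=k[U_\pi]$, let $I_\pi$ be the ideal generated by all differences $X-X'$ of occurrences that correspond to each other across a link (for an axiom or cut link on $B,\neg B$ the $i$-th of the $n$ atoms of $B$ corresponds to the $(n+1-i)$-th atom of $\neg B$; for a tensor or par link the atoms of the premises correspond to the same atoms in the conclusion), and let $R_\pi=P_\pi/I_\pi$. Let $\approx$ be the equivalence relation on $U_\pi$ generated by these correspondences; its classes underlie the persistent paths. Let $Z_1,\dots,Z_n$ be the atoms of $A$ on the conclusion edge. The numbers of positive and of negative ones are equal,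 say $m$; write $U_1,\dots,U_m$ and $V_1,\dots,V_m$ for the subsequences of positive and negative atoms. The maps $\beta_+:k[U_1,\dots,U_m]\to R_\pi$ and $\beta_-:k[V_1,\dots,V_m]\to R_\pi$ are isomorphisms, and $\sigma$ is the permutation of $\{1,\dots,m\}$ with $\beta_-^{-1}\beta_+(U_i)=V_{\sigma(i)}$; the atoms $V_{\sigma(i)}$ and $U_i$ are $\approx$-equivalent, i.e. on the same persistent path. Let $\hat\sigma$ be the involution of $\{1,\dots,n\}$ that exchanges, for each $i\le m$, the positions of $U_i$ and $V_{\sigma(i)}$ in $Z_1,\dots,Z_n$. On the finite set $\Omega_\pi$ of atom occurrences on conclusions of axiom links, let $\alpha$ be the permutation exchanging corresponding atoms of the two conclusions of each axiom link, and let $\gamma$ be the permutation that exchanges two elements which descend through tensor and par links to corresponding atoms of the two premises of a cut link, and fixes the elements which descend to the conclusion of $\pi$. The geometry of interaction permutation $\delta_\pi$ of $\Omega_\pi$ sends an element $x$ which descends to the conclusion to the first of $\alpha x,\ \alpha\gamma\alpha x,\ \alpha\gamma\alpha\gamma\alpha x,\dots$ which descends to the conclusion, and fixes the elements which descend to a cut.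 Identify each $Z_j$ with the unique element of $\Omega_\pi$ which descends to it. Then $$\delta_\pi(Z_j)=Z_{\hat\sigma(j)}\qquad\text{for all } j=1,\dots,n .$$ -/

import Mathlib

/-! ### Formulas -/

/-- Formulas of multiplicative linear logic over a set `𝒳` of unoriented atoms.  The oriented atom
`(X, +)` is `atom X true` and `(X, -)` is `atom X false`.  Each class of pre-formulas modulo the
equations `¬(A ⊗ B) = ¬B ⅋ ¬A`, `¬(A ⅋ B) = ¬B ⊗ ¬A`, `¬(X, x) = (X, x̄)` contains exactly one
pre-formula without negation signs, and it is this representative which is recorded. -/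
inductive Formula (𝒳 : Type*) where
  | atom (X : 𝒳) (x : Bool) : Formula 𝒳
  | tensor (A B : Formula 𝒳) : Formula 𝒳
  | par (A B : Formula 𝒳) : Formula 𝒳

namespace Formula

/-- Negation. -/
def neg {𝒳 : Type*} : Formula 𝒳 → Formula 𝒳
  | atom X x => atom X (!x)
  | tensor A B => par B.neg A.neg
  | par A B => tensor B.neg A.neg

/-- The sequence of oriented atoms of a formula. -/
def atoms {𝒳 : Type*} : Formula 𝒳 → List (𝒳 × Bool)
  | atom X x => [(X, x)]
  | tensor A B => A.atoms ++ B.atoms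
  | par A B => A.atoms ++ B.atoms

theorem neg_neg {𝒳 : Type*} (A : Formula 𝒳) : A.neg.neg = A := by
  induction A <;> simp_all [neg]

theorem atoms_length_neg {𝒳 : Type*} (A : Formula 𝒳) :
    A.neg.atoms.length = A.atoms.length := by
  induction A <;> simp_all [neg, atoms, Nat.add_comm]

theorem atoms_length_pos {𝒳 : Type*} (A : Formula 𝒳) : 0 < A.atoms.length := by
  induction A <;> simp_all [atoms]

/-- The indices of the positive atoms in the sequence of oriented atoms of `A`. -/
def posIndices {𝒳 : Type*} (A : Formula 𝒳) : Finset (Fin A.atoms.length) :=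
  Finset.univ.filter fun i => (A.atoms.get i).2 = true

/-- The indices of the negative atoms in the sequence of oriented atoms of `A`. -/
def negIndices {𝒳 : Type*} (A : Formula 𝒳) : Finset (Fin A.atoms.length) :=
  Finset.univ.filter fun i => (A.atoms.get i).2 = false

/-- The position of the `i`-th positive atom in the sequence of oriented atoms of `A`, where `m` is
the number of positive atoms. -/
def posIndex {𝒳 : Type*} (A : Formula 𝒳) {m : ℕ} (h : A.posIndices.card = m) (i : Fin m) :
    Fin A.atoms.length :=
  A.posIndices.orderEmbOfFin h i

/-- The position of the `i`-th negative atom in the sequence of oriented atoms of `A`, where `m` is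
the number of negative atoms. -/
def negIndex {𝒳 : Type*} (A : Formula 𝒳) {m : ℕ} (h : A.negIndices.card = m) (i : Fin m) :
    Fin A.atoms.length :=
  A.negIndices.orderEmbOfFin h i

end Formula

/-! ### Proof structures -/

/-- The labels of the vertices of a proof structure; `concl` is the label `c`. -/
inductive VertexLabel where
  | ax | cut | tensor | par | concl

/-- Directed multigraphs with vertices labelled by `VertexLabel` and edges labelled by formulas.
`left e` says that `e` is the left one among the premises of its target; it is only meaningful when
this target is labelled `⊗` or `⅋`. -/
structure LabelledGraph (𝒳 : Type*) where
  /-- vertices -/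
  V : Type
  /-- edges -/
  E : Type
  /-- source of an edge -/
  src : E → V
  /-- target of an edge -/
  tgt : E → V
  /-- label of a vertex -/
  kind : V → VertexLabel
  /-- label of an edge -/
  lab : E → Formula 𝒳
  /-- being a left premise -/
  left : E → Prop

/-- Isomorphism of labelled graphs. -/
def LabelledGraph.Isomorphic {𝒳 : Type*} (G H : LabelledGraph 𝒳) : Prop :=
  ∃ (f : G.V ≃ H.V) (g : G.E ≃ H.E),
    (∀ e, H.src (g e) = f (G.src e)) ∧ (∀ e, H.tgt (g e) = f (G.tgt e)) ∧
    (∀ v, H.kind (f v) = G.kind v) ∧ (∀ e, H.lab (g e) = G.lab e) ∧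
    (∀ e, G.kind (G.tgt e) = .tensor ∨ G.kind (G.tgt e) = .par → (H.left (g e) ↔ G.left e))

/-- Proof structures (finite, as usual). -/
structure ProofStructure (𝒳 : Type*) extends LabelledGraph 𝒳 where
  finite_V : Finite V
  finite_E : Finite E
  ax_spec : ∀ v, kind v = .ax → (∀ e, tgt e ≠ v) ∧
    ∃ e₁ e₂, e₁ ≠ e₂ ∧ (∀ e, src e = v ↔ e = e₁ ∨ e = e₂) ∧ lab e₂ = (lab e₁).neg
  cut_spec : ∀ v, kind v = .cut → (∀ e, src e ≠ v) ∧
    ∃ e₁ e₂, e₁ ≠ e₂ ∧ (∀ e, tgt e = v ↔ e = e₁ ∨ e = e₂) ∧ lab e₂ = (lab e₁).neg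
  tensor_spec : ∀ v, kind v = .tensor → ∃ a b c, a ≠ b ∧ left a ∧ ¬ left b ∧
    (∀ e, tgt e = v ↔ e = a ∨ e = b) ∧ (∀ e, src e = v ↔ e = c) ∧
    lab c = (lab a).tensor (lab b)
  par_spec : ∀ v, kind v = .par → ∃ a b c, a ≠ b ∧ left a ∧ ¬ left b ∧
    (∀ e, tgt e = v ↔ e = a ∨ e = b) ∧ (∀ e, src e = v ↔ e = c) ∧
    lab c = (lab a).par (lab b)
  concl_spec : ∀ v, kind v = .concl → (∀ e, src e ≠ v) ∧ ∃ e, ∀ e', tgt e' = v ↔ e' = e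

/-! ### The sequent calculus and the translation to proof structures -/

/-- Exchange the entries at positions `i` and `i + 1` (do nothing if there are no such entries). -/
def List.exchangeAt {α : Type*} : ℕ → List α → List α
  | 0, a :: b :: l => b :: a :: l
  | i + 1, a :: l => a :: List.exchangeAt i l
  | _, l => l

/-- Proofs in the one-sided sequent calculus of multiplicative linear logic (without units);
`SequentProof Γ` is the type of proofs of `⊢ Γ`. -/
inductive SequentProof {𝒳 : Type*} : List (Formula 𝒳) → Type _ where
  | ax (A : Formula 𝒳) : SequentProof [A.neg, A]
  | exchange {Γ : List (Formula 𝒳)} (i : ℕ) (d : SequentProof Γ) : SequentProof (Γ.exchangeAt i)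
  | cut {A : Formula 𝒳} {Γ Δ : List (Formula 𝒳)} (d : SequentProof (A :: Γ))
      (d' : SequentProof (A.neg :: Δ)) : SequentProof (Γ ++ Δ)
  | tensor {A B : Formula 𝒳} {Γ Δ : List (Formula 𝒳)} (d : SequentProof (A :: Γ))
      (d' : SequentProof (B :: Δ)) : SequentProof (A.tensor B :: (Γ ++ Δ))
  | par {A B : Formula 𝒳} {Γ : List (Formula 𝒳)} (d : SequentProof (A :: B :: Γ)) :
      SequentProof (A.par B :: Γ)

/-- A graph as `LabelledGraph`, but before the vertices labelled `c` have been attached: `L` is the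
set of links, `tgt e = none` means that the edge `e` is still pending, and `out` lists the pending
edges in the order of the formulas of the sequent. -/
structure OpenGraph (𝒳 : Type*) where
  /-- links -/
  L : Type
  /-- edges -/
  E : Type
  /-- source of an edge -/
  src : E → L
  /-- target of an edge, if it has one -/
  tgt : E → Option L
  /-- label of a link -/
  kind : L → VertexLabel
  /-- label of an edge -/
  lab : E → Formula 𝒳
  /-- being a left premise -/
  left : E → Prop
  /-- pending edges -/
  out : List E

namespace OpenGraph

/-- A single axiom link with conclusions `¬A, A`. -/
abbrev axiomLink {𝒳 : Type*} (A : Formula 𝒳) : OpenGraph 𝒳 where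
  L := Unit
  E := Bool
  src _ := ()
  tgt _ := none
  kind _ := .ax
  lab e := if e then A else A.neg
  left _ := False
  out := [false, true]

/-- Reorder the pending edges. -/
abbrev exchange {𝒳 : Type*} (G : OpenGraph 𝒳) (i : ℕ) : OpenGraph 𝒳 :=
  { G with out := G.out.exchangeAt i }

open Classical in
/-- Connect the first pending edges of `G` and `H` by a new cut link `none`. -/
noncomputable abbrev cutLink {𝒳 : Type*} (G H : OpenGraph 𝒳) : OpenGraph 𝒳 where
  L := Option (G.L ⊕ H.L)
  E := G.E ⊕ H.E
  src := Sum.elim (fun e => some (.inl (G.src e))) (fun e => some (.inr (H.src e)))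
  tgt := Sum.elim
    (fun e => if G.out[0]? = some e then some none else (G.tgt e).map fun l => some (.inl l))
    (fun e => if H.out[0]? = some e then some none else (H.tgt e).map fun l => some (.inr l))
  kind l := l.elim .cut (Sum.elim G.kind H.kind)
  lab := Sum.elim G.lab H.lab
  left := Sum.elim G.left H.left
  out := G.out.tail.map .inl ++ H.out.tail.map .inr

open Classical in
/-- Make the first pending edges of `G` and `H` the left and the right premise of a new tensor link
`none`, whose conclusion is a new pending edge `none` with label `C`. -/
noncomputable abbrev tensorLink {𝒳 : Type*} (C : Formula 𝒳) (G H : OpenGraph 𝒳) : OpenGraph 𝒳 where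
  L := Option (G.L ⊕ H.L)
  E := Option (G.E ⊕ H.E)
  src e := e.elim none
    (Sum.elim (fun e => some (.inl (G.src e))) (fun e => some (.inr (H.src e))))
  tgt e := e.elim none (Sum.elim
    (fun e => if G.out[0]? = some e then some none else (G.tgt e).map fun l => some (.inl l))
    (fun e => if H.out[0]? = some e then some none else (H.tgt e).map fun l => some (.inr l)))
  kind l := l.elim .tensor (Sum.elim G.kind H.kind)
  lab e := e.elim C (Sum.elim G.lab H.lab)
  left e := e.elim False (Sum.elim
    (fun e => if G.out[0]? = some e then True else G.left e)
    (fun e => if H.out[0]? = some e then False else H.left e))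
  out := none :: (G.out.tail.map (fun e => some (.inl e)) ++
    H.out.tail.map (fun e => some (.inr e)))

open Classical in
/-- Make the first two pending edges of `G` the left and the right premise of a new par link
`none`, whose conclusion is a new pending edge `none` with label `C`. -/
noncomputable abbrev parLink {𝒳 : Type*} (C : Formula 𝒳) (G : OpenGraph 𝒳) : OpenGraph 𝒳 where
  L := Option G.L
  E := Option G.E
  src e := e.map G.src
  tgt e := e.elim none fun e =>
    if G.out[0]? = some e ∨ G.out[1]? = some e then some none else (G.tgt e).map some
  kind l := l.elim .par G.kind
  lab e := e.elim C G.lab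
  left e := e.elim False fun e =>
    if G.out[0]? = some e then True else if G.out[1]? = some e then False else G.left e
  out := none :: G.out.tail.tail.map some

/-- Attach a vertex labelled `c` to every pending edge. -/
abbrev close {𝒳 : Type*} (G : OpenGraph 𝒳) : LabelledGraph 𝒳 where
  V := G.L ⊕ {e : G.E // G.tgt e = none}
  E := G.E
  src e := .inl (G.src e)
  tgt e := match h : G.tgt e with
    | some l => .inl l
    | none => .inr ⟨e, h⟩
  kind := Sum.elim G.kind fun _ => .concl
  lab := G.lab
  left := G.left

end OpenGraph

/-- The graph of links and edges of a sequent calculus proof. -/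
noncomputable def SequentProof.openGraph {𝒳 : Type*} :
    {Γ : List (Formula 𝒳)} → SequentProof Γ → OpenGraph 𝒳
  | _, .ax A => OpenGraph.axiomLink A
  | _, .exchange i d => d.openGraph.exchange i
  | _, .cut d d' => OpenGraph.cutLink d.openGraph d'.openGraph
  | _, .tensor (A := A) (B := B) d d' =>
      OpenGraph.tensorLink (A.tensor B) d.openGraph d'.openGraph
  | _, .par (A := A) (B := B) d => OpenGraph.parLink (A.par B) d.openGraph

/-- The translation of sequent calculus proofs to proof structures. -/
noncomputable abbrev SequentProof.translate {𝒳 : Type*} {Γ : List (Formula 𝒳)} (d : SequentProof Γ) :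
    LabelledGraph 𝒳 :=
  d.openGraph.close

namespace ProofStructure

/-- A proof net is a proof structure which is (up to renaming of vertices and edges) the
translation of a sequent calculus proof. -/
def IsProofNet {𝒳 : Type*} (π : ProofStructure 𝒳) : Prop :=
  ∃ (Γ : List (Formula 𝒳)) (d : SequentProof Γ), d.translate.Isomorphic π.toLabelledGraph

/-- `e` is the only conclusion of `π`. -/
def IsSingleConclusion {𝒳 : Type*} (π : ProofStructure 𝒳) (e : π.E) : Prop :=
  ∀ e', π.kind (π.tgt e') = .concl ↔ e' = e

/-! ### The coordinate ring -/

/-- The set `U_π` of unoriented atoms of `π`: pairs of an edge and an index in the sequence of atoms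
of the formula on this edge. -/
abbrev UAtom {𝒳 : Type*} (π : ProofStructure 𝒳) : Type :=
  (e : π.E) × Fin (π.lab e).atoms.length

/-- `u` and `v` are corresponding atoms of the two conclusions `A`, `¬A` of an axiom link.  As
`¬(A ⊗ B) = ¬B ⅋ ¬A`, the sequence of atoms of `¬A` is reversed. -/
def AxRel {𝒳 : Type*} (π : ProofStructure 𝒳) (u v : π.UAtom) : Prop :=
  π.kind (π.src u.1) = .ax ∧ π.src u.1 = π.src v.1 ∧ u.1 ≠ v.1 ∧
    (u.2 : ℕ) + v.2 + 1 = (π.lab u.1).atoms.length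

/-- `u` and `v` are corresponding atoms of the two premises `A`, `¬A` of a cut link. -/
def CutRel {𝒳 : Type*} (π : ProofStructure 𝒳) (u v : π.UAtom) : Prop :=
  π.kind (π.tgt u.1) = .cut ∧ π.tgt u.1 = π.tgt v.1 ∧ u.1 ≠ v.1 ∧
    (u.2 : ℕ) + v.2 + 1 = (π.lab u.1).atoms.length

/-- `u` is an atom of a premise of a tensor or par link and `v` is the corresponding atom of the
conclusion of this link. -/
def DownRel {𝒳 : Type*} (π : ProofStructure 𝒳) (u v : π.UAtom) : Prop :=
  (π.kind (π.tgt u.1) = .tensor ∨ π.kind (π.tgt u.1) = .par) ∧ π.tgt u.1 = π.src v.1 ∧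
    ((π.left u.1 ∧ (v.2 : ℕ) = u.2) ∨
     (¬ π.left u.1 ∧ ∃ a, π.tgt a = π.tgt u.1 ∧ π.left a ∧
        (v.2 : ℕ) = (π.lab a).atoms.length + u.2))

/-- `u - v` is one of the generators attached to a link. -/
def LinkRel {𝒳 : Type*} (π : ProofStructure 𝒳) (u v : π.UAtom) : Prop :=
  π.AxRel u v ∨ π.CutRel u v ∨ π.DownRel u v

/-- The set `G_π`, the union of the generating sets of all links.  (For axiom and cut links it
contains both `X - X'` and `X' - X`, which does not affect the ideal.) -/
def generators {𝒳 : Type*} (k : Type*) [Field k] (π : ProofStructure 𝒳) :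
    Set (MvPolynomial π.UAtom k) :=
  {f | ∃ u v, π.LinkRel u v ∧ f = MvPolynomial.X u - MvPolynomial.X v}

/-- The defining ideal `I_π` in `P_π = k[U_π]`. -/
noncomputable def definingIdeal {𝒳 : Type*} (k : Type*) [Field k] (π : ProofStructure 𝒳) :
    Ideal (MvPolynomial π.UAtom k) :=
  Ideal.span (π.generators k)

/-- The coordinate ring `R_π = P_π / I_π`. -/
abbrev CoordinateRing {𝒳 : Type*} (k : Type*) [Field k] (π : ProofStructure 𝒳) :=
  MvPolynomial π.UAtom k ⧸ π.definingIdeal k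

/-- The `i`-th positive unoriented atom `U_i` on the edge `e`. -/
def posAtom {𝒳 : Type*} (π : ProofStructure 𝒳) (e : π.E) {m : ℕ}
    (h : (π.lab e).posIndices.card = m) (i : Fin m) : π.UAtom :=
  ⟨e, (π.lab e).posIndex h i⟩

/-- The `i`-th negative unoriented atom `V_i` on the edge `e`. -/
def negAtom {𝒳 : Type*} (π : ProofStructure 𝒳) (e : π.E) {m : ℕ}
    (h : (π.lab e).negIndices.card = m) (i : Fin m) : π.UAtom :=
  ⟨e, (π.lab e).negIndex h i⟩

/-- The map `k[x_1, …, x_m] ⟶ P_π ⟶ R_π` for a family `x_1, …, x_m` of unoriented atoms. -/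
noncomputable def toCoordinateRing {𝒳 : Type*} (k : Type*) [Field k] (π : ProofStructure 𝒳)
    {m : ℕ} (x : Fin m → π.UAtom) : MvPolynomial (Fin m) k →ₐ[k] π.CoordinateRing k :=
  (Ideal.Quotient.mkₐ k (π.definingIdeal k)).comp (MvPolynomial.rename x)

/-- The equivalence relation `≈` on `U_π` generated by the links; its classes are the underlying
sets of the persistent paths. -/
def SamePath {𝒳 : Type*} (π : ProofStructure 𝒳) : π.UAtom → π.UAtom → Prop :=
  Relation.EqvGen π.LinkRel

/-! ### Descending from the axiom links -/

section Descent

variable {𝒳 : Type*} (π : ProofStructure 𝒳)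

/-- `u` descends to `v` through tensor and par links. -/
def Descends : π.UAtom → π.UAtom → Prop :=
  Relation.ReflTransGen π.DownRel

/-- Atoms on conclusions of axiom links. -/
def IsTop (u : π.UAtom) : Prop := π.kind (π.src u.1) = .ax

/-- Atoms on premises of cut links and on conclusions of `π`. -/
def IsBottom (u : π.UAtom) : Prop :=
  π.kind (π.tgt u.1) = .cut ∨ π.kind (π.tgt u.1) = .concl

variable {π}

theorem src_kind (e : π.E) : π.kind (π.src e) = .ax ∨ π.kind (π.src e) = .tensor ∨
    π.kind (π.src e) = .par := by
  cases h : π.kind (π.src e)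
  · simp
  · exact absurd rfl ((π.cut_spec _ h).1 e)
  · simp
  · simp
  · exact absurd rfl ((π.concl_spec _ h).1 e)

theorem tgt_kind (e : π.E) : (π.kind (π.tgt e) = .cut ∨ π.kind (π.tgt e) = .concl) ∨
    (π.kind (π.tgt e) = .tensor ∨ π.kind (π.tgt e) = .par) := by
  cases h : π.kind (π.tgt e)
  · exact absurd rfl ((π.ax_spec _ h).1 e)
  all_goals simp

theorem binary_spec {v : π.V} (h : π.kind v = .tensor ∨ π.kind v = .par) :
    ∃ a b c, a ≠ b ∧ π.left a ∧ ¬ π.left b ∧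
    (∀ e, π.tgt e = v ↔ e = a ∨ e = b) ∧ (∀ e, π.src e = v ↔ e = c) ∧
    (π.lab c).atoms.length = (π.lab a).atoms.length + (π.lab b).atoms.length := by
  rcases h with h | h
  · obtain ⟨a, b, c, h1, h2, h3, h4, h5, h6⟩ := π.tensor_spec v h
    exact ⟨a, b, c, h1, h2, h3, h4, h5, by simp [h6, Formula.atoms]⟩
  · obtain ⟨a, b, c, h1, h2, h3, h4, h5, h6⟩ := π.par_spec v h
    exact ⟨a, b, c, h1, h2, h3, h4, h5, by simp [h6, Formula.atoms]⟩

theorem uatom_ext {u v : π.UAtom} (h : u.1 = v.1) (h' : (u.2 : ℕ) = v.2) : u = v := by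
  obtain ⟨e, i⟩ := u
  obtain ⟨e', i'⟩ := v
  obtain rfl : e = e' := h
  simpa [Fin.ext_iff] using h'

theorem DownRel.right_unique {u v v' : π.UAtom} (h : π.DownRel u v) (h' : π.DownRel u v') :
    v = v' := by
  obtain ⟨a, b, c, hab, ha, hb, ht, hs, -⟩ := binary_spec h.1
  have h1 := (hs _).1 h.2.1.symm
  have h2 := (hs _).1 h'.2.1.symm
  refine uatom_ext (h1.trans h2.symm) ?_
  rcases h.2.2 with ⟨hl, e1⟩ | ⟨hl, x, hx, hxl, e1⟩ <;>
    rcases h'.2.2 with ⟨hl', e2⟩ | ⟨hl', y, hy, hyl, e2⟩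
  · omega
  · exact absurd hl hl'
  · exact absurd hl' hl
  · have hx' : x = a := by grind
    have hy' : y = a := by grind
    subst hx' hy'
    omega

theorem DownRel.left_unique {u u' v : π.UAtom} (h : π.DownRel u v) (h' : π.DownRel u' v) :
    u = u' := by
  obtain ⟨a, b, c, hab, ha, hb, ht, hs, -⟩ := binary_spec h.1
  have e1 := (ht _).1 rfl
  have e2 := (ht _).1 (h'.2.1.trans h.2.1.symm)
  have l1 := u.2.2
  have l2 := u'.2.2
  rcases h.2.2 with ⟨hl, e3⟩ | ⟨hl, x, hx, hxl, e3⟩ <;>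
    rcases h'.2.2 with ⟨hl', e4⟩ | ⟨hl', y, hy, hyl, e4⟩
  · refine uatom_ext (by grind) (by omega)
  · have hy' : y = u.1 := by grind
    subst hy'
    omega
  · have hx' : x = u'.1 := by grind
    subst hx'
    omega
  · have hx' : x = a := by grind
    have hy' : y = a := by grind
    subst hx' hy'
    refine uatom_ext (by grind) (by omega)

theorem DownRel.length_lt {u v : π.UAtom} (h : π.DownRel u v) :
    (π.lab u.1).atoms.length < (π.lab v.1).atoms.length := by
  obtain ⟨a, b, c, hab, ha, hb, ht, hs, hl⟩ := binary_spec h.1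
  have e1 := (ht _).1 rfl
  have e2 := (hs _).1 h.2.1.symm
  have := (π.lab a).atoms_length_pos
  have := (π.lab b).atoms_length_pos
  rw [e2, hl]
  rcases e1 with e1 | e1 <;> rw [e1] <;> omega

theorem exists_down {u : π.UAtom} (h : ¬ π.IsBottom u) : ∃ v, π.DownRel u v := by
  have hk := (tgt_kind u.1).resolve_left h
  obtain ⟨a, b, c, hab, ha, hb, ht, hs, hl⟩ := binary_spec hk
  have hc := (hs c).2 rfl
  have l1 := u.2.2
  rcases (ht _).1 rfl with e | e
  · exact ⟨⟨c, u.2, by rw [← e] at hl; omega⟩, hk, hc.symm, .inl ⟨e ▸ ha, rfl⟩⟩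
  · exact ⟨⟨c, (π.lab a).atoms.length + u.2, by rw [← e] at hl; omega⟩, hk, hc.symm,
      .inr ⟨e ▸ hb, a, (ht a).2 (.inl rfl), ha, rfl⟩⟩

theorem exists_up {v : π.UAtom} (h : ¬ π.IsTop v) : ∃ u, π.DownRel u v := by
  have hk := (src_kind v.1).resolve_left h
  obtain ⟨a, b, c, hab, ha, hb, ht, hs, hl⟩ := binary_spec hk
  have hc := (hs _).1 rfl
  have hta := (ht a).2 (.inl rfl)
  have htb := (ht b).2 (.inr rfl)
  have l1 := v.2.2
  by_cases hi : (v.2 : ℕ) < (π.lab a).atoms.length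
  · exact ⟨⟨a, v.2, hi⟩, by simpa only [hta] using hk, hta, .inl ⟨ha, rfl⟩⟩
  · refine ⟨⟨b, v.2 - (π.lab a).atoms.length, by rw [← hc] at hl; omega⟩,
      by simpa only [htb] using hk, htb, .inr ⟨hb, a, hta.trans htb.symm, ha, ?_⟩⟩
    simp only
    omega

theorem not_down_of_isBottom {u v : π.UAtom} (h : π.IsBottom u) : ¬ π.DownRel u v := by
  intro hd
  have := hd.1
  unfold IsBottom at h
  grind

theorem not_up_of_isTop {u v : π.UAtom} (h : π.IsTop v) : ¬ π.DownRel u v := by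
  intro hd
  have := hd.1
  rw [hd.2.1] at this
  unfold IsTop at h
  grind

theorem exists_top (v : π.UAtom) : ∃ u, π.IsTop u ∧ π.Descends u v := by
  induction hn : (π.lab v.1).atoms.length using Nat.strong_induction_on generalizing v with
  | _ n ih =>
    by_cases h : π.IsTop v
    · exact ⟨v, h, .refl⟩
    · obtain ⟨u, hu⟩ := exists_up h
      obtain ⟨x, hx, hxu⟩ := ih _ (hn ▸ hu.length_lt) u rfl
      exact ⟨x, hx, hxu.tail hu⟩

theorem exists_bottom (u : π.UAtom) : ∃ v, π.IsBottom v ∧ π.Descends u v := by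
  have := π.finite_E
  obtain ⟨N, hN⟩ := (Set.finite_range fun e : π.E => (π.lab e).atoms.length).bddAbove
  induction hn : N - (π.lab u.1).atoms.length using Nat.strong_induction_on
    generalizing u with
  | _ n ih =>
    by_cases h : π.IsBottom u
    · exact ⟨u, h, .refl⟩
    · obtain ⟨v, hv⟩ := exists_down h
      have h1 := hv.length_lt
      have h2 : (π.lab v.1).atoms.length ≤ N := hN ⟨v.1, rfl⟩
      obtain ⟨x, hx, hxu⟩ := ih _ (by omega) v rfl
      exact ⟨x, hx, .head hv hxu⟩

theorem Descends.eq_of_isBottom {u v : π.UAtom} (h : π.Descends u v) (hu : π.IsBottom u) :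
    v = u := by
  rcases h.cases_head with h | ⟨w, hw, -⟩
  · exact h.symm
  · exact absurd hw (not_down_of_isBottom hu)

theorem Descends.eq_of_isTop {u v : π.UAtom} (h : π.Descends u v) (hv : π.IsTop v) :
    u = v := by
  rcases h.cases_tail with h | ⟨w, -, hw⟩
  · exact h.symm
  · exact absurd hw (not_up_of_isTop hv)

theorem bottom_unique {u v v' : π.UAtom} (h : π.Descends u v) (h' : π.Descends u v')
    (hv : π.IsBottom v) (hv' : π.IsBottom v') : v = v' := by
  rcases Relation.ReflTransGen.total_of_right_unique
    (fun _ _ _ => DownRel.right_unique) h h' with h | h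
  · exact (Descends.eq_of_isBottom h hv).symm
  · exact Descends.eq_of_isBottom h hv'

theorem top_unique {u u' v : π.UAtom} (h : π.Descends u v) (h' : π.Descends u' v)
    (hu : π.IsTop u) (hu' : π.IsTop u') : u = u' := by
  induction h with
  | refl => exact (Descends.eq_of_isTop h' hu).symm
  | tail hb hc ih =>
    rcases h'.cases_tail with e | ⟨w, hw, hwc⟩
    · subst e
      exact absurd hc (not_up_of_isTop hu')
    · exact ih (DownRel.left_unique hwc hc ▸ hw)

end Descent

/-! ### The geometry of interaction permutation -/

section GoI

variable {𝒳 : Type*} (π : ProofStructure 𝒳)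

/-- The disjoint union of the sets of unoriented atoms of all conclusions of axiom links. -/
abbrev AxAtom : Type := {u : π.UAtom // π.IsTop u}

/-- The set of unoriented atoms on premises of cut links and on conclusions of `π`. -/
abbrev BottomAtom : Type := {u : π.UAtom // π.IsBottom u}

/-- The atom on a conclusion of an axiom link from which a given atom comes. -/
noncomputable def top (v : π.UAtom) : π.AxAtom :=
  ⟨(exists_top v).choose, (exists_top v).choose_spec.1⟩

/-- The atom on a premise of a cut link or on a conclusion of `π` to which a given atom descends. -/
noncomputable def bottom (u : π.UAtom) : π.BottomAtom :=
  ⟨(exists_bottom u).choose, (exists_bottom u).choose_spec.1⟩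

variable {π}

theorem top_descends (v : π.UAtom) : π.Descends (π.top v).1 v :=
  (exists_top v).choose_spec.2

theorem descends_bottom (u : π.UAtom) : π.Descends u (π.bottom u).1 :=
  (exists_bottom u).choose_spec.2

theorem top_bottom (x : π.AxAtom) : π.top (π.bottom x.1).1 = x :=
  Subtype.ext (top_unique (top_descends _) (descends_bottom x.1) (π.top _).2 x.2)

theorem bottom_top (v : π.BottomAtom) : π.bottom (π.top v.1).1 = v :=
  Subtype.ext (bottom_unique (descends_bottom _) (top_descends v.1) (π.bottom _).2 v.2)

variable (π)

/-- Each atom on a conclusion of an axiom link descends to exactly one bottom atom, and this is a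
bijection. -/
noncomputable def axAtomEquivBottomAtom : π.AxAtom ≃ π.BottomAtom where
  toFun x := π.bottom x.1
  invFun v := π.top v.1
  left_inv := top_bottom
  right_inv := bottom_top

variable {π}

theorem existsUnique_axRel {u : π.UAtom} (h : π.IsTop u) : ∃! v, π.AxRel u v := by
  obtain ⟨-, e₁, e₂, hne, hs, hl⟩ := π.ax_spec _ h
  have hlen : (π.lab e₂).atoms.length = (π.lab e₁).atoms.length := by
    rw [hl, Formula.atoms_length_neg]
  have l1 := u.2.2
  have key : ∀ e, e ≠ u.1 → π.src u.1 = π.src e →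
      (π.lab e).atoms.length = (π.lab u.1).atoms.length → ∃! v, π.AxRel u v := by
    intro e he hse hle
    refine ⟨⟨e, (π.lab u.1).atoms.length - 1 - u.2, by omega⟩,
      ⟨h, hse, he.symm, by simp only; omega⟩, ?_⟩
    rintro v ⟨-, h2, h3, h4⟩
    have h5 := (hs _).1 h2.symm
    have h6 := (hs _).1 hse.symm
    have h7 := (hs _).1 rfl
    refine uatom_ext (by grind) (by simp only; omega)
  rcases (hs _).1 rfl with e | e
  · exact key e₂ (by rw [e]; exact hne.symm) ((hs e₂).2 (.inr rfl)).symm (by rw [e, hlen])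
  · exact key e₁ (by rw [e]; exact hne) ((hs e₁).2 (.inl rfl)).symm (by rw [e, hlen])

theorem existsUnique_cutRel {u : π.UAtom} (h : π.kind (π.tgt u.1) = .cut) :
    ∃! v, π.CutRel u v := by
  obtain ⟨-, e₁, e₂, hne, hs, hl⟩ := π.cut_spec _ h
  have hlen : (π.lab e₂).atoms.length = (π.lab e₁).atoms.length := by
    rw [hl, Formula.atoms_length_neg]
  have l1 := u.2.2
  have key : ∀ e, e ≠ u.1 → π.tgt u.1 = π.tgt e →
      (π.lab e).atoms.length = (π.lab u.1).atoms.length → ∃! v, π.CutRel u v := by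
    intro e he hse hle
    refine ⟨⟨e, (π.lab u.1).atoms.length - 1 - u.2, by omega⟩,
      ⟨h, hse, he.symm, by simp only; omega⟩, ?_⟩
    rintro v ⟨-, h2, h3, h4⟩
    have h5 := (hs _).1 h2.symm
    have h6 := (hs _).1 hse.symm
    have h7 := (hs _).1 rfl
    refine uatom_ext (by grind) (by simp only; omega)
  rcases (hs _).1 rfl with e | e
  · exact key e₂ (by rw [e]; exact hne.symm) ((hs e₂).2 (.inr rfl)).symm (by rw [e, hlen])
  · exact key e₁ (by rw [e]; exact hne) ((hs e₁).2 (.inl rfl)).symm (by rw [e, hlen])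

theorem AxRel.symm {u v : π.UAtom} (h : π.AxRel u v) : π.AxRel v u := by
  obtain ⟨-, e₁, e₂, hne, hs, hl⟩ := π.ax_spec _ h.1
  have hlen : (π.lab e₂).atoms.length = (π.lab e₁).atoms.length := by
    rw [hl, Formula.atoms_length_neg]
  have h5 := (hs _).1 h.2.1.symm
  have h7 := (hs _).1 rfl
  have h8 := h.2.2.2
  exact ⟨h.2.1 ▸ h.1, h.2.1.symm, h.2.2.1.symm, by grind⟩

theorem CutRel.symm {u v : π.UAtom} (h : π.CutRel u v) : π.CutRel v u := by
  obtain ⟨-, e₁, e₂, hne, hs, hl⟩ := π.cut_spec _ h.1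
  have hlen : (π.lab e₂).atoms.length = (π.lab e₁).atoms.length := by
    rw [hl, Formula.atoms_length_neg]
  have h5 := (hs _).1 h.2.1.symm
  have h7 := (hs _).1 rfl
  have h8 := h.2.2.2
  exact ⟨h.2.1 ▸ h.1, h.2.1.symm, h.2.2.1.symm, by grind⟩

variable (π)

/-- The corresponding atom on the other conclusion of the axiom link. -/
noncomputable def axMate (x : π.AxAtom) : π.AxAtom :=
  ⟨(existsUnique_axRel x.2).choose, (existsUnique_axRel x.2).choose_spec.1.symm.1⟩

open Classical in
/-- The corresponding atom on the other premise of the cut link; atoms on conclusions of `π` are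
fixed. -/
noncomputable def cutMate (u : π.BottomAtom) : π.BottomAtom :=
  if h : π.kind (π.tgt u.1.1) = .cut then
    ⟨(existsUnique_cutRel h).choose, .inl (existsUnique_cutRel h).choose_spec.1.symm.1⟩
  else u

variable {π}

theorem axRel_axMate (x : π.AxAtom) : π.AxRel x.1 (π.axMate x).1 :=
  (existsUnique_axRel x.2).choose_spec.1

theorem axMate_involutive : Function.Involutive π.axMate := fun x =>
  Subtype.ext ((existsUnique_axRel (π.axMate x).2).unique (axRel_axMate _)
    (axRel_axMate x).symm)

theorem cutRel_cutMate {u : π.BottomAtom} (h : π.kind (π.tgt u.1.1) = .cut) :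
    π.CutRel u.1 (π.cutMate u).1 := by
  unfold cutMate
  rw [dif_pos h]
  exact (existsUnique_cutRel h).choose_spec.1

theorem cutMate_of_ne {u : π.BottomAtom} (h : π.kind (π.tgt u.1.1) ≠ .cut) :
    π.cutMate u = u := by
  unfold cutMate
  rw [dif_neg h]

theorem cutMate_involutive : Function.Involutive π.cutMate := by
  intro u
  by_cases h : π.kind (π.tgt u.1.1) = .cut
  · have h1 := (cutRel_cutMate h).symm
    exact Subtype.ext ((existsUnique_cutRel h1.1).unique (cutRel_cutMate h1.1) h1)
  · rw [cutMate_of_ne h, cutMate_of_ne h]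

variable (π)

/-- The permutation `α_π`, which exchanges corresponding atoms of the two conclusions of each axiom
link. -/
noncomputable def axPerm : Equiv.Perm π.AxAtom :=
  axMate_involutive.toPerm

/-- The permutation `γ_π`, which exchanges atoms that descend to corresponding atoms of the two
premises of a cut link, and fixes the atoms that descend to a conclusion of `π`. -/
noncomputable def cutPerm : Equiv.Perm π.AxAtom :=
  π.axAtomEquivBottomAtom.symm.permCongr cutMate_involutive.toPerm

instance : Finite π.AxAtom := by
  have := π.finite_E
  infer_instance

/-- The atoms on conclusions of axiom links which descend to a conclusion of `π`. -/
def visible : Set π.AxAtom :=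
  {x | π.kind (π.tgt (π.bottom x.1).1.1) = .concl}

end GoI

end ProofStructure

section FirstReturn

variable {α : Type*} [Finite α] (f : Equiv.Perm α) {S : Set α}

theorem exists_return {x : α} (hx : x ∈ S) : ∃ n, 0 < n ∧ (f ^ n) x ∈ S :=
  ⟨orderOf f, orderOf_pos f, by simpa [pow_orderOf_eq_one] using hx⟩

variable (S)

open Classical in
/-- The first return map of a permutation `f` of a finite set to a subset `S`: a point `x` of `S` is
sent to `f ^ n x` with `n ≥ 1` minimal such that this is in `S`; the points outside of `S` are
fixed. -/
noncomputable def firstReturnFun (x : α) : α :=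
  if hx : x ∈ S then (f ^ Nat.find (exists_return f hx)) x else x

variable {S}

theorem firstReturnFun_mem {x : α} (hx : x ∈ S) : firstReturnFun f S x ∈ S := by
  classical
  unfold firstReturnFun
  rw [dif_pos hx]
  convert (Nat.find_spec (exists_return f hx)).2

theorem firstReturnFun_of_notMem {x : α} (hx : x ∉ S) : firstReturnFun f S x = x := by
  unfold firstReturnFun
  rw [dif_neg hx]

theorem exists_firstReturnFun {x : α} (hx : x ∈ S) : ∃ n, 0 < n ∧
    firstReturnFun f S x = (f ^ n) x ∧ ∀ m, 0 < m → (f ^ m) x ∈ S → n ≤ m := by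
  classical
  refine ⟨Nat.find (exists_return f hx), (Nat.find_spec (exists_return f hx)).1, ?_, ?_⟩
  · unfold firstReturnFun
    rw [dif_pos hx]
  · exact fun m h1 h2 => Nat.find_min' _ ⟨h1, h2⟩

variable (S)

theorem firstReturnFun_injective : Function.Injective (firstReturnFun f S) := by
  have key : ∀ (n m : ℕ) (x y : α), x ∈ S → 0 < n → n ≤ m → (f ^ n) x = (f ^ m) y →
      (∀ l, 0 < l → (f ^ l) y ∈ S → m ≤ l) → x = y := by
    intro n m x y hx hn hnm h hmin
    obtain ⟨d, rfl⟩ := Nat.exists_eq_add_of_le hnm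
    rw [pow_add, Equiv.Perm.mul_apply] at h
    have h' := (f ^ n).injective h
    rcases Nat.eq_zero_or_pos d with rfl | hd
    · simpa using h'
    · have := hmin d hd (h' ▸ hx)
      omega
  intro x y h
  by_cases hx : x ∈ S <;> by_cases hy : y ∈ S
  · obtain ⟨n, hn, e1, m1⟩ := exists_firstReturnFun f hx
    obtain ⟨m, hm, e2, m2⟩ := exists_firstReturnFun f hy
    rw [e1, e2] at h
    rcases le_total n m with hnm | hnm
    · exact key n m x y hx hn hnm h m2
    · exact (key m n y x hy hm hnm h.symm m1).symm
  · rw [firstReturnFun_of_notMem f hy] at h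
    exact absurd (h ▸ firstReturnFun_mem f hx) hy
  · rw [firstReturnFun_of_notMem f hx] at h
    exact absurd (h ▸ firstReturnFun_mem f hy) hx
  · rwa [firstReturnFun_of_notMem f hx, firstReturnFun_of_notMem f hy] at h

/-- The first return map as a permutation. -/
noncomputable def firstReturn : Equiv.Perm α :=
  Equiv.ofBijective (firstReturnFun f S)
    (Finite.injective_iff_bijective.1 (firstReturnFun_injective f S))

end FirstReturn

/-- The permutation `δ_π`: starting from an atom `x` which descends to a conclusion of `π`, cross
axiom links and cut links alternately, and stop as soon as a conclusion is reached, so that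
`δ_π x` is the first of `α x, αγα x, αγαγα x, …` which descends to a conclusion.  The atoms which
descend to a cut link are fixed. -/
noncomputable def ProofStructure.goiPerm {𝒳 : Type*} (π : ProofStructure 𝒳) :
    Equiv.Perm π.AxAtom :=
  firstReturn (π.axPerm * π.cutPerm) π.visible

/-! The heart of the matter is that a proof net has no persistent path avoiding its conclusion. This
is extracted from coherence spaces. Given a union `S` of path classes, imagine two experiments on
the net which assign different points to exactly the atoms in `S`, distinct points of a positive
atom being coherent. On every edge the two resulting points of the formula are then equal, strictly
coherent or strictly incoherent, and `Formula.coherence` records this as a sign. Duality reverses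
the sign (`coherence_neg`). By induction on the sequent proof, either all signs vanish or some
pending formula has sign `1` (`SequentProof.coherent`): the interpretation of a proof is a clique,
and each of its points comes from only one experiment. If `S` misses the conclusion, the sign there
is `0`, so all signs are `0` and `S` is empty (`IsProofNet.eq_empty`).

The rest is the combinatorics of two involutions. A visible atom is fixed by `γ`, so the path
through it is traced by applying `α` and `γ` alternately until another visible atom is reached; this
stretch is stable under both, hence is the whole path, and its visible atoms are exactly `x` and `δ
x` (`eq_or_eq_goiPerm`). Every crossing of an axiom or a cut reverses the orientation, and the
number of crossings is odd, so `x` and `δ x` have opposite signs (`orientation_goiPerm`).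

Hence `δ` induces on the positions of the conclusion a sign-reversing involution `t` whose orbits
are the intersections with the persistent paths. Each path thus contains exactly one positive and
one negative atom of the conclusion. This makes `β₊` and `β₋` isomorphisms, since the coordinate
ring has one free variable per path, and it forces the permutation induced by `t` to be `σ`. -/

namespace Formula

/-! ### Coherence signs of formulas -/

/-- The sign of a tensor product whose factors have the given signs. -/
def tensorSign (a b : SignType) : SignType :=
  if a = -1 ∨ b = -1 then -1 else if a = 0 then b else 1

theorem tensorSign_comm (a b : SignType) : tensorSign a b = tensorSign b a := by
  revert a b; decide

theorem tensorSign_eq_zero {a b : SignType} : tensorSign a b = 0 ↔ a = 0 ∧ b = 0 := by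
  revert a b; decide

/-- Compare two points of the coherence space `A` whose coordinates differ exactly at the atoms
where `s` is true: the value is `1` if they are strictly coherent, `0` if they are equal, and
`-1` if they are strictly incoherent.  Distinct points of a positive atom are coherent. -/
def coherence {𝒳 : Type*} : Formula 𝒳 → (ℕ → Bool) → SignType
  | atom _ x, s => if s 0 then (if x then 1 else -1) else 0
  | tensor A B, s =>
      tensorSign (A.coherence s) (B.coherence fun i => s (A.atoms.length + i))
  | par A B, s =>
      -tensorSign (-A.coherence s) (-B.coherence fun i => s (A.atoms.length + i))

theorem forall_lt_add {P : ℕ → Prop} {m n : ℕ} :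
    (∀ i < m + n, P i) ↔ (∀ i < m, P i) ∧ ∀ i < n, P (m + i) := by
  refine ⟨fun h => ⟨fun i hi => h i (by omega), fun i hi => h _ (by omega)⟩, fun h i hi => ?_⟩
  by_cases hm : i < m
  · exact h.1 i hm
  · have := h.2 (i - m) (by omega)
    rwa [Nat.add_sub_cancel' (by omega)] at this

/-- Two points of a tensor or a par are equal only if both components are. This turns vanishing
signs into emptiness of a set of atoms. -/
theorem coherence_eq_zero {𝒳 : Type*} {A : Formula 𝒳} {s : ℕ → Bool} :
    A.coherence s = 0 ↔ ∀ i < A.atoms.length, s i = false := by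
  induction A generalizing s with
  | atom X x => cases x <;> cases h : s 0 <;> simp [coherence, atoms, h]
  | tensor A B ihA ihB =>
    simp only [coherence, atoms, List.length_append, tensorSign_eq_zero, ihA, ihB, forall_lt_add]
  | par A B ihA ihB =>
    have (a : SignType) : -a = 0 ↔ a = 0 := by revert a; decide
    simp only [coherence, atoms, List.length_append, tensorSign_eq_zero, ihA, ihB, forall_lt_add,
      this]

/-- De Morgan duality. Negation reverses the sequence of atoms and hence swaps the two factors,
which the commutativity of `tensorSign` absorbs. -/
theorem coherence_neg {𝒳 : Type*} {A : Formula 𝒳} {s s' : ℕ → Bool}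
    (h : ∀ i j, i + j + 1 = A.atoms.length → s i = s' j) :
    A.neg.coherence s' = -A.coherence s := by
  induction A generalizing s s' with
  | atom X x =>
    have := h 0 0 rfl
    cases x <;> cases h : s 0 <;> simp_all [coherence, neg]
  | tensor A B ihA ihB =>
    simp only [atoms, List.length_append] at h
    simp only [neg, coherence, atoms_length_neg]
    rw [ihB (s := fun i => s (A.atoms.length + i)) fun i j hij => h _ _ (by omega),
      ihA (s := s) fun i j hij => h _ _ (by omega), tensorSign_comm]
    simp
  | par A B ihA ihB =>
    simp only [atoms, List.length_append] at h
    simp only [neg, coherence, atoms_length_neg]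
    rw [ihB (s := fun i => s (A.atoms.length + i)) fun i j hij => h _ _ (by omega),
      ihA (s := s) fun i j hij => h _ _ (by omega), tensorSign_comm]
    simp

theorem coherence_tensor_eq_one {𝒳 : Type*} {A B : Formula 𝒳} {s : ℕ → Bool}
    (hA : A.coherence s = 0 ∨ A.coherence s = 1)
    (hB : B.coherence (fun i => s (A.atoms.length + i)) = 0 ∨
      B.coherence (fun i => s (A.atoms.length + i)) = 1)
    (h : A.coherence s = 1 ∨ B.coherence (fun i => s (A.atoms.length + i)) = 1) :
    (A.tensor B).coherence s = 1 := by
  rw [coherence]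
  generalize A.coherence s = a at *
  generalize B.coherence _ = b at *
  revert a b
  decide

/-- For a par, one strictly coherent component suffices whatever the sign of the other; a tensor
also needs the other to be nonnegative. -/
theorem coherence_par_eq_one {𝒳 : Type*} {A B : Formula 𝒳} {s : ℕ → Bool}
    (h : A.coherence s = 1 ∨ B.coherence (fun i => s (A.atoms.length + i)) = 1) :
    (A.par B).coherence s = 1 := by
  rw [coherence]
  generalize A.coherence s = a at *
  generalize B.coherence _ = b at *
  revert a b
  decide

theorem coherence_congr {𝒳 : Type*} {A : Formula 𝒳} {s s' : ℕ → Bool}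
    (h : ∀ i < A.atoms.length, s i = s' i) : A.coherence s = A.coherence s' := by
  induction A generalizing s s' with
  | atom X x => simp [coherence, h 0 (by simp [atoms])]
  | tensor A B ihA ihB =>
    simp only [atoms, List.length_append, forall_lt_add] at h
    simp only [coherence]
    rw [ihA h.1, ihB h.2]
  | par A B ihA ihB =>
    simp only [atoms, List.length_append, forall_lt_add] at h
    simp only [coherence]
    rw [ihA h.1, ihB h.2]

theorem atoms_neg {𝒳 : Type*} (A : Formula 𝒳) :
    A.neg.atoms = (A.atoms.map fun p => (p.1, !p.2)).reverse := by
  induction A <;> simp_all [neg, atoms]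

end Formula

/-! ### Exchange in lists -/

theorem List.exchangeAt_perm {α : Type*} (i : ℕ) (l : List α) : (l.exchangeAt i).Perm l := by
  induction i generalizing l with
  | zero =>
    rcases l with _ | ⟨a, _ | ⟨b, l⟩⟩
    · exact .refl _
    · exact .refl _
    · exact .swap _ _ _
  | succ i ih =>
    rcases l with _ | ⟨a, l⟩
    · exact .refl _
    · exact (ih l).cons a

theorem List.map_exchangeAt {α β : Type*} (f : α → β) (i : ℕ) (l : List α) :
    (l.exchangeAt i).map f = (l.map f).exchangeAt i := by
  induction i generalizing l with
  | zero => rcases l with _ | ⟨a, _ | ⟨b, l⟩⟩ <;> simp [List.exchangeAt]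
  | succ i ih => rcases l with _ | ⟨a, l⟩ <;> simp [List.exchangeAt, ih]

/-! ### Soundness of the coherence signs for each rule -/

namespace OpenGraph

variable {𝒳 : Type*}

/-- The list `out` consists of distinct edges without target, labelled by the formulas of `Γ`. -/
structure HasOutputs (G : OpenGraph 𝒳) (Γ : List (Formula 𝒳)) : Prop where
  map_lab : G.out.map G.lab = Γ
  nodup : G.out.Nodup
  tgt_eq_none : ∀ e ∈ G.out, G.tgt e = none

/-- A set of atoms of `G`, given by its indicator function, is closed if it is a union of classes
of the equivalence relation generated by the links. -/
structure Closed (G : OpenGraph 𝒳) (S : G.E → ℕ → Bool) : Prop where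
  ax : ∀ e e' i j, G.kind (G.src e) = .ax → G.src e = G.src e' → e ≠ e' →
    i + j + 1 = (G.lab e).atoms.length → S e i = S e' j
  cut : ∀ e e' l i j, G.tgt e = some l → G.tgt e' = some l → G.kind l = .cut → e ≠ e' →
    i + j + 1 = (G.lab e).atoms.length → S e i = S e' j
  left : ∀ e c i, (G.kind (G.src c) = .tensor ∨ G.kind (G.src c) = .par) →
    G.tgt e = some (G.src c) → G.left e → i < (G.lab e).atoms.length → S c i = S e i
  right : ∀ e a c i, (G.kind (G.src c) = .tensor ∨ G.kind (G.src c) = .par) →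
    G.tgt e = some (G.src c) → ¬ G.left e → G.tgt a = some (G.src c) → G.left a →
    i < (G.lab e).atoms.length → S c ((G.lab a).atoms.length + i) = S e i

/-- Restricts a closed set to a premise of a rule. Targets and `left` are compared only at edges
which already have a target, since a rule changes both at the pending edges that it consumes. -/
theorem Closed.comp {G H : OpenGraph 𝒳} {S : H.E → ℕ → Bool} (h : H.Closed S) (φ : G.E → H.E)
    (ψ : G.L → H.L) (hφ : Function.Injective φ) (hsrc : ∀ e, H.src (φ e) = ψ (G.src e))
    (htgt : ∀ e l, G.tgt e = some l → H.tgt (φ e) = some (ψ l))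
    (hkind : ∀ l, H.kind (ψ l) = G.kind l) (hlab : ∀ e, H.lab (φ e) = G.lab e)
    (hleft : ∀ e, G.tgt e ≠ none → (H.left (φ e) ↔ G.left e)) :
    G.Closed fun e => S (φ e) where
  ax e e' i j h1 h2 h3 h4 := h.ax _ _ i j (by rw [hsrc, hkind, h1]) (by rw [hsrc, hsrc, h2])
    (hφ.ne h3) (by rw [hlab, h4])
  cut e e' l i j h1 h2 h3 h4 h5 := h.cut _ _ (ψ l) i j (htgt _ _ h1) (htgt _ _ h2)
    (by rw [hkind, h3]) (hφ.ne h4) (by rw [hlab, h5])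
  left e c i h1 h2 h3 h4 := h.left _ _ i (by rw [hsrc, hkind]; exact h1)
    (by rw [hsrc]; exact htgt _ _ h2) ((hleft e (by simp [h2])).2 h3) (by rw [hlab]; exact h4)
  right e a c i h1 h2 h3 h4 h5 h6 := by
    have := h.right (φ e) (φ a) (φ c) i (by rw [hsrc, hkind]; exact h1)
      (by rw [hsrc]; exact htgt _ _ h2) (by rwa [hleft e (by simp [h2])])
      (by rw [hsrc]; exact htgt _ _ h4) ((hleft a (by simp [h4])).2 h5) (by rw [hlab]; exact h6)
    rwa [hlab] at this

/-- Every nonempty closed set of atoms makes some pending formula strictly coherent. -/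
def Coherent (G : OpenGraph 𝒳) : Prop :=
  ∀ S, G.Closed S → (∀ e, (G.lab e).coherence (S e) = 0) ∨
    ∃ e ∈ G.out, (G.lab e).coherence (S e) = 1

theorem HasOutputs.exists_cons {G : OpenGraph 𝒳} {A : Formula 𝒳} {Γ : List (Formula 𝒳)}
    (h : G.HasOutputs (A :: Γ)) : ∃ a l, G.out = a :: l ∧ G.lab a = A ∧ l.map G.lab = Γ := by
  have := h.map_lab
  rcases ho : G.out with _ | ⟨a, l⟩
  · simp [ho] at this
  · rw [ho, List.map_cons, List.cons.injEq] at this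
    exact ⟨a, l, rfl, this⟩

theorem hasOutputs_axiomLink (A : Formula 𝒳) : (axiomLink A).HasOutputs [A.neg, A] := by
  constructor <;> simp

/-- The two conclusions carry opposite signs, so both vanish or one of them is `1`. -/
theorem coherent_axiomLink (A : Formula 𝒳) : (axiomLink A).Coherent := by
  intro S hS
  have h : A.neg.coherence (S false) = -A.coherence (S true) :=
    Formula.coherence_neg fun i j hij => hS.ax true false i j rfl rfl (by simp) (by simpa using hij)
  have h' (a : SignType) : a = 0 ∨ a = 1 ∨ -a = 1 := by revert a; decide
  rcases h' (A.coherence (S true)) with h0 | h0 | h0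
  · exact .inl (by rintro (_ | _) <;> simp [h, h0])
  · exact .inr ⟨true, by simp, by simpa using h0⟩
  · exact .inr ⟨false, by simp, by simpa [h] using h0⟩

theorem HasOutputs.exchange {G : OpenGraph 𝒳} {Γ : List (Formula 𝒳)} (h : G.HasOutputs Γ)
    (i : ℕ) : (G.exchange i).HasOutputs (Γ.exchangeAt i) where
  map_lab := by rw [← h.map_lab, ← List.map_exchangeAt]
  nodup := (List.exchangeAt_perm _ _).nodup_iff.2 h.nodup
  tgt_eq_none e he := h.tgt_eq_none e ((List.exchangeAt_perm _ _).mem_iff.1 he)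

theorem Coherent.exchange {G : OpenGraph 𝒳} (h : G.Coherent) (i : ℕ) :
    (G.exchange i).Coherent := by
  intro S hS
  refine (h S ⟨hS.ax, hS.cut, hS.left, hS.right⟩).imp_right ?_
  rintro ⟨e, he, h1⟩
  exact ⟨e, (List.exchangeAt_perm _ _).mem_iff.2 he, h1⟩

theorem HasOutputs.cutLink {G H : OpenGraph 𝒳} {A B : Formula 𝒳} {Γ Δ : List (Formula 𝒳)}
    (hG : G.HasOutputs (A :: Γ)) (hH : H.HasOutputs (B :: Δ)) :
    (cutLink G H).HasOutputs (Γ ++ Δ) := by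
  obtain ⟨a, l, ha, -, hl⟩ := hG.exists_cons
  obtain ⟨b, r, hb, -, hr⟩ := hH.exists_cons
  have nG := hG.nodup
  have nH := hH.nodup
  have tG := hG.tgt_eq_none
  have tH := hH.tgt_eq_none
  rw [ha] at nG tG
  rw [hb] at nH tH
  rw [List.nodup_cons] at nG nH
  constructor
  · simp [ha, hb, ← hl, ← hr, Function.comp_def]
  · simp only [ha, hb, List.tail_cons]
    refine List.Nodup.append (nG.2.map Sum.inl_injective) (nH.2.map Sum.inr_injective) ?_
    simp [List.disjoint_left]
  · simp only [ha, hb, List.tail_cons, List.mem_append, List.mem_map]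
    rintro _ (⟨e, he, rfl⟩ | ⟨e, he, rfl⟩)
    · have : a ≠ e := by rintro rfl; exact nG.1 he
      simp [ha, this, tG e (by simp [he])]
    · have : b ≠ e := by rintro rfl; exact nH.1 he
      simp [hb, this, tH e (by simp [he])]

theorem HasOutputs.tensorLink {G H : OpenGraph 𝒳} {A B : Formula 𝒳} {Γ Δ : List (Formula 𝒳)}
    (C : Formula 𝒳) (hG : G.HasOutputs (A :: Γ)) (hH : H.HasOutputs (B :: Δ)) :
    (tensorLink C G H).HasOutputs (C :: (Γ ++ Δ)) := by
  obtain ⟨a, l, ha, -, hl⟩ := hG.exists_cons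
  obtain ⟨b, r, hb, -, hr⟩ := hH.exists_cons
  have nG := hG.nodup
  have nH := hH.nodup
  have tG := hG.tgt_eq_none
  have tH := hH.tgt_eq_none
  rw [ha] at nG tG
  rw [hb] at nH tH
  rw [List.nodup_cons] at nG nH
  constructor
  · simp [ha, hb, ← hl, ← hr, Function.comp_def]
  · simp only [ha, hb, List.tail_cons, List.nodup_cons]
    refine ⟨by simp, List.Nodup.append
      (nG.2.map ((Option.some_injective _).comp Sum.inl_injective))
      (nH.2.map ((Option.some_injective _).comp Sum.inr_injective)) ?_⟩
    simp [List.disjoint_left]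
  · simp only [ha, hb, List.tail_cons, List.mem_append, List.mem_map, List.mem_cons]
    rintro _ (rfl | ⟨e, he, rfl⟩ | ⟨e, he, rfl⟩)
    · rfl
    · have : a ≠ e := by rintro rfl; exact nG.1 he
      simp [ha, this, tG e (by simp [he])]
    · have : b ≠ e := by rintro rfl; exact nH.1 he
      simp [hb, this, tH e (by simp [he])]

theorem HasOutputs.exists_cons_cons {G : OpenGraph 𝒳} {A B : Formula 𝒳} {Γ : List (Formula 𝒳)}
    (h : G.HasOutputs (A :: B :: Γ)) : ∃ a b l, G.out = a :: b :: l ∧ G.lab a = A ∧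
      G.lab b = B ∧ l.map G.lab = Γ ∧ a ≠ b ∧ a ∉ l ∧ b ∉ l ∧ l.Nodup := by
  have := h.map_lab
  have hn := h.nodup
  rcases ho : G.out with _ | ⟨a, _ | ⟨b, l⟩⟩
  · simp [ho] at this
  · simp [ho] at this
  · rw [ho, List.map_cons, List.map_cons, List.cons.injEq, List.cons.injEq] at this
    simp only [ho, List.nodup_cons, List.mem_cons, not_or] at hn
    exact ⟨a, b, l, rfl, this.1, this.2.1, this.2.2, hn.1.1, hn.1.2, hn.2.1, hn.2.2⟩

theorem HasOutputs.parLink {G : OpenGraph 𝒳} {A B : Formula 𝒳} {Γ : List (Formula 𝒳)}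
    (C : Formula 𝒳) (hG : G.HasOutputs (A :: B :: Γ)) :
    (parLink C G).HasOutputs (C :: Γ) := by
  obtain ⟨a, b, l, ho, -, -, hl, -, ha, hb, hn⟩ := hG.exists_cons_cons
  have tG := hG.tgt_eq_none
  rw [ho] at tG
  constructor
  · simp [ho, ← hl, Function.comp_def]
  · simp only [ho, List.tail_cons, List.nodup_cons]
    exact ⟨by simp, hn.map (Option.some_injective _)⟩
  · simp only [ho, List.tail_cons, List.mem_map, List.mem_cons]
    rintro _ (rfl | ⟨e, he, rfl⟩)
    · rfl
    · have h1 : a ≠ e := by rintro rfl; exact ha he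
      have h2 : b ≠ e := by rintro rfl; exact hb he
      simp [ho, h1, h2, tG e (by simp [he])]

/-- The two premises of the cut carry opposite signs. If a cut premise is what makes one side
coherent, the other premise has sign `-1`, so the other side must owe its coherence to a formula
which survives the cut. -/
theorem Coherent.cutLink {G H : OpenGraph 𝒳} {A : Formula 𝒳} {Γ Δ : List (Formula 𝒳)}
    (hG : G.HasOutputs (A :: Γ)) (hH : H.HasOutputs (A.neg :: Δ)) (cG : G.Coherent)
    (cH : H.Coherent) : (cutLink G H).Coherent := by
  obtain ⟨a, l, ha, rfl, -⟩ := hG.exists_cons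
  obtain ⟨b, r, hb, hab, -⟩ := hH.exists_cons
  have tG := hG.tgt_eq_none
  have tH := hH.tgt_eq_none
  intro S hS
  have neG : ∀ e, G.tgt e ≠ none → a ≠ e := by
    rintro e he rfl; exact he (tG _ (by simp [ha]))
  have neH : ∀ e, H.tgt e ≠ none → b ≠ e := by
    rintro e he rfl; exact he (tH _ (by simp [hb]))
  have sG := cG _ (hS.comp .inl (fun l => some (.inl l)) Sum.inl_injective (fun _ => rfl)
    (fun e l h => by simp [ha, neG e (by simp [h]), h]) (fun _ => rfl) (fun _ => rfl)
    (fun _ _ => .rfl))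
  have sH := cH _ (hS.comp .inr (fun l => some (.inr l)) Sum.inr_injective (fun _ => rfl)
    (fun e l h => by simp [hb, neH e (by simp [h]), h]) (fun _ => rfl) (fun _ => rfl)
    (fun _ _ => .rfl))
  have key : (G.lab a).neg.coherence (S (.inr b)) = -(G.lab a).coherence (S (.inl a)) :=
    Formula.coherence_neg fun i j hij => hS.cut (.inl a) (.inr b) none i j (by simp [ha])
      (by simp [hb]) rfl (by simp) hij
  rw [← hab] at key
  simp only [ha, hb, List.mem_cons, exists_eq_or_imp] at sG sH
  have out : (∃ e ∈ l, (G.lab e).coherence (S (.inl e)) = 1) ∨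
      (∃ e ∈ r, (H.lab e).coherence (S (.inr e)) = 1) → ∃ e ∈ (OpenGraph.cutLink G H).out,
        ((OpenGraph.cutLink G H).lab e).coherence (S e) = 1 := by
    rintro (⟨e, he, h⟩ | ⟨e, he, h⟩)
    · exact ⟨.inl e, by simp [ha, he], h⟩
    · exact ⟨.inr e, by simp [hb, he], h⟩
  rcases sG with sG | sG | sG
  · rcases sH with sH | sH | sH
    · exact .inl (by rintro (e | e); exacts [sG e, sH e])
    · rw [key, sG a] at sH
      simp at sH
    · exact .inr (out (.inr sH))
  · rcases sH with sH | sH | sH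
    · have := sH b
      rw [key, sG] at this
      simp at this
    · rw [key, sG] at sH
      exact absurd sH (by decide)
    · exact .inr (out (.inr sH))
  · exact .inr (out (.inl sG))

/-- If neither context supplies a strictly coherent formula, both premises have sign `0` or `1`:
either one is `1` and so is the tensor, or all signs vanish on both sides. -/
theorem Coherent.tensorLink {G H : OpenGraph 𝒳} {A B : Formula 𝒳} {Γ Δ : List (Formula 𝒳)}
    (hG : G.HasOutputs (A :: Γ)) (hH : H.HasOutputs (B :: Δ)) (cG : G.Coherent)
    (cH : H.Coherent) : (tensorLink (A.tensor B) G H).Coherent := by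
  obtain ⟨a, l, ha, rfl, -⟩ := hG.exists_cons
  obtain ⟨b, r, hb, rfl, -⟩ := hH.exists_cons
  have tG := hG.tgt_eq_none
  have tH := hH.tgt_eq_none
  intro S hS
  have neG : ∀ e, G.tgt e ≠ none → a ≠ e := by
    rintro e he rfl; exact he (tG _ (by simp [ha]))
  have neH : ∀ e, H.tgt e ≠ none → b ≠ e := by
    rintro e he rfl; exact he (tH _ (by simp [hb]))
  have sG := cG _ (hS.comp (fun e => some (.inl e)) (fun l => some (.inl l))
    ((Option.some_injective _).comp Sum.inl_injective) (fun _ => rfl)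
    (fun e l h => by simp [ha, neG e (by simp [h]), h]) (fun _ => rfl) (fun _ => rfl)
    (fun e h => by simp [ha, neG e h]))
  have sH := cH _ (hS.comp (fun e => some (.inr e)) (fun l => some (.inr l))
    ((Option.some_injective _).comp Sum.inr_injective) (fun _ => rfl)
    (fun e l h => by simp [hb, neH e (by simp [h]), h]) (fun _ => rfl) (fun _ => rfl)
    (fun e h => by simp [hb, neH e h]))
  have keyA : (G.lab a).coherence (S none) = (G.lab a).coherence (S (some (.inl a))) :=
    Formula.coherence_congr fun i hi => hS.left (some (.inl a)) none i (.inl rfl) (by simp [ha])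
      (by simp [ha]) hi
  have keyB : (H.lab b).coherence (fun i => S none ((G.lab a).atoms.length + i)) =
      (H.lab b).coherence (S (some (.inr b))) :=
    Formula.coherence_congr fun i hi => hS.right (some (.inr b)) (some (.inl a)) none i (.inl rfl)
      (by simp [hb]) (by simp [hb]) (by simp [ha]) (by simp [ha]) hi
  simp only [ha, hb, List.mem_cons, exists_eq_or_imp] at sG sH
  have out : (∃ e ∈ l, (G.lab e).coherence (S (some (.inl e))) = 1) ∨
      (∃ e ∈ r, (H.lab e).coherence (S (some (.inr e))) = 1) →
      ∃ e ∈ (OpenGraph.tensorLink ((G.lab a).tensor (H.lab b)) G H).out,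
        ((OpenGraph.tensorLink ((G.lab a).tensor (H.lab b)) G H).lab e).coherence (S e) = 1 := by
    rintro (⟨e, he, h⟩ | ⟨e, he, h⟩)
    · exact ⟨some (.inl e), by simp [ha, he], h⟩
    · exact ⟨some (.inr e), by simp [hb, he], h⟩
  rw [← or_assoc] at sG sH
  rcases sG with sG | sG
  · rcases sH with sH | sH
    · by_cases h : (G.lab a).coherence (S none) = 1 ∨
        (H.lab b).coherence (fun i => S none ((G.lab a).atoms.length + i)) = 1
      · refine .inr ⟨none, by simp, Formula.coherence_tensor_eq_one ?_ ?_ h⟩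
        · rw [keyA]
          exact sG.imp_left fun h => h a
        · rw [keyB]
          exact sH.imp_left fun h => h b
      -- Neither premise has sign `1`, so the first alternative, vanishing of all signs, holds on
      -- both sides.
      · rw [keyA, keyB, not_or] at h
        have sG := sG.resolve_right h.1
        have sH := sH.resolve_right h.2
        left
        rintro (_ | e | e)
        · change Formula.tensorSign _ _ = 0
          rw [keyA, keyB, Formula.tensorSign_eq_zero]
          exact ⟨sG a, sH b⟩
        · exact sG e
        · exact sH e
    · exact .inr (out (.inr sH))
  · exact .inr (out (.inl sG))

theorem Coherent.parLink {G : OpenGraph 𝒳} {A B : Formula 𝒳} {Γ : List (Formula 𝒳)}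
    (hG : G.HasOutputs (A :: B :: Γ)) (cG : G.Coherent) :
    (parLink (A.par B) G).Coherent := by
  obtain ⟨a, b, l, ho, rfl, rfl, -, hab, -⟩ := hG.exists_cons_cons
  have tG := hG.tgt_eq_none
  intro S hS
  have neA : ∀ e, G.tgt e ≠ none → a ≠ e := by
    rintro e he rfl; exact he (tG _ (by simp [ho]))
  have neB : ∀ e, G.tgt e ≠ none → b ≠ e := by
    rintro e he rfl; exact he (tG _ (by simp [ho]))
  have sG := cG _ (hS.comp some some (Option.some_injective _) (fun _ => rfl)
    (fun e l h => by simp [ho, neA e (by simp [h]), neB e (by simp [h]), h]) (fun _ => rfl)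
    (fun _ => rfl) (fun e h => by simp [ho, neA e h, neB e h]))
  have keyA : (G.lab a).coherence (S none) = (G.lab a).coherence (S (some a)) :=
    Formula.coherence_congr fun i hi => hS.left (some a) none i (.inr rfl) (by simp [ho])
      (by simp [ho]) hi
  have keyB : (G.lab b).coherence (fun i => S none ((G.lab a).atoms.length + i)) =
      (G.lab b).coherence (S (some b)) :=
    Formula.coherence_congr fun i hi => hS.right (some b) (some a) none i (.inr rfl)
      (by simp [ho]) (by simp [ho, hab]) (by simp [ho]) (by simp [ho]) hi
  simp only [ho, List.mem_cons, exists_eq_or_imp] at sG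
  rw [← or_assoc (a := _ = _)] at sG
  rcases sG with sG | sG | ⟨e, he, h⟩
  · left
    rintro (_ | e)
    · rw [Formula.coherence_eq_zero]
      change ∀ i < ((G.lab a).atoms ++ (G.lab b).atoms).length, _
      rw [List.length_append, Formula.forall_lt_add, ← Formula.coherence_eq_zero,
        ← Formula.coherence_eq_zero (s := fun i => S none (_ + i)), keyA, keyB]
      exact ⟨sG a, sG b⟩
    · exact sG e
  · exact .inr ⟨none, by simp, Formula.coherence_par_eq_one (by rwa [keyA, keyB])⟩
  · exact .inr ⟨some e, by simp [ho, he], h⟩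

end OpenGraph

theorem SequentProof.hasOutputs {𝒳 : Type*} {Γ : List (Formula 𝒳)} (d : SequentProof Γ) :
    d.openGraph.HasOutputs Γ := by
  induction d with
  | ax A => exact OpenGraph.hasOutputs_axiomLink A
  | exchange i d ih => exact ih.exchange i
  | cut d d' ih ih' => exact ih.cutLink ih'
  | tensor d d' ih ih' => exact ih.tensorLink _ ih'
  | par d ih => exact ih.parLink _

theorem SequentProof.coherent {𝒳 : Type*} {Γ : List (Formula 𝒳)} (d : SequentProof Γ) :
    d.openGraph.Coherent := by
  induction d with
  | ax A => exact OpenGraph.coherent_axiomLink A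
  | exchange i d ih => exact ih.exchange i
  | cut d d' ih ih' => exact .cutLink d.hasOutputs d'.hasOutputs ih ih'
  | tensor d d' ih ih' => exact .tensorLink d.hasOutputs d'.hasOutputs ih ih'
  | par d ih => exact .parLink d.hasOutputs ih

/-! ### Orientation of atoms across links -/

namespace ProofStructure

variable {𝒳 : Type*} {π : ProofStructure 𝒳}

theorem lab_of_ax {e e' : π.E} (h : π.kind (π.src e) = .ax) (hs : π.src e = π.src e')
    (hne : e ≠ e') : π.lab e' = (π.lab e).neg := by
  obtain ⟨-, e₁, e₂, -, hs', hl⟩ := π.ax_spec _ h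
  rcases (hs' e).1 rfl with rfl | rfl <;> rcases (hs' e').1 hs.symm with rfl | rfl
  · exact absurd rfl hne
  · exact hl
  · rw [hl, Formula.neg_neg]
  · exact absurd rfl hne

theorem lab_of_cut {e e' : π.E} (h : π.kind (π.tgt e) = .cut) (hs : π.tgt e = π.tgt e')
    (hne : e ≠ e') : π.lab e' = (π.lab e).neg := by
  obtain ⟨-, e₁, e₂, -, hs', hl⟩ := π.cut_spec _ h
  rcases (hs' e).1 rfl with rfl | rfl <;> rcases (hs' e').1 hs.symm with rfl | rfl
  · exact absurd rfl hne
  · exact hl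
  · rw [hl, Formula.neg_neg]
  · exact absurd rfl hne

theorem lab_of_binary {a b c : π.E} (h : π.kind (π.src c) = .tensor ∨ π.kind (π.src c) = .par)
    (ha : π.tgt a = π.src c) (hb : π.tgt b = π.src c) (hla : π.left a) (hlb : ¬ π.left b) :
    (π.lab c).atoms = (π.lab a).atoms ++ (π.lab b).atoms := by
  rcases h with h | h
  · obtain ⟨a', b', c', -, hla', hlb', ht, hs, hl⟩ := π.tensor_spec _ h
    obtain rfl : a = a' := by grind
    obtain rfl : b = b' := by grind
    obtain rfl : c = c' := by grind
    rw [hl, Formula.atoms]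
  · obtain ⟨a', b', c', -, hla', hlb', ht, hs, hl⟩ := π.par_spec _ h
    obtain rfl : a = a' := by grind
    obtain rfl : b = b' := by grind
    obtain rfl : c = c' := by grind
    rw [hl, Formula.atoms]

theorem eq_of_src_eq {c c' : π.E} (h : π.kind (π.src c) = .tensor ∨ π.kind (π.src c) = .par)
    (hc : π.src c = π.src c') : c = c' := by
  obtain ⟨-, -, c₀, -, -, -, -, hs, -⟩ := binary_spec h
  exact ((hs c).1 rfl).trans ((hs c').1 hc.symm).symm

/-- The orientation of an atom. -/
def orientation (u : π.UAtom) : Bool := ((π.lab u.1).atoms.get u.2).2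

/-- The sequence of atoms of the dual formula is reversed with signs flipped, and the index
condition picks out the reversed position. -/
theorem orientation_eq_not {u v : π.UAtom} (hl : π.lab v.1 = (π.lab u.1).neg)
    (h : (u.2 : ℕ) + v.2 + 1 = (π.lab u.1).atoms.length) :
    orientation v = !orientation u := by
  have h1 : (π.lab v.1).atoms = ((π.lab u.1).atoms.map fun p => (p.1, !p.2)).reverse := by
    rw [hl, Formula.atoms_neg]
  have h2 : (π.lab u.1).atoms.length - 1 - v.2 = u.2 := by omega
  simp only [orientation, List.get_eq_getElem, List.getElem_of_eq h1, List.getElem_reverse,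
    List.getElem_map, List.length_map, h2]

theorem AxRel.orientation {u v : π.UAtom} (h : π.AxRel u v) :
    orientation v = !orientation u :=
  orientation_eq_not (lab_of_ax h.1 h.2.1 h.2.2.1) h.2.2.2

theorem CutRel.orientation {u v : π.UAtom} (h : π.CutRel u v) :
    orientation v = !orientation u :=
  orientation_eq_not (lab_of_cut h.1 h.2.1 h.2.2.1) h.2.2.2

theorem DownRel.orientation {u v : π.UAtom} (h : π.DownRel u v) :
    orientation v = orientation u := by
  obtain ⟨a, b, c, hab, ha, hb, ht, hs, -⟩ := binary_spec h.1
  have hk := h.1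
  rw [h.2.1] at hk
  have h1 := lab_of_binary hk (((ht a).2 (.inl rfl)).trans h.2.1)
    (((ht b).2 (.inr rfl)).trans h.2.1) ha hb
  simp only [ProofStructure.orientation, List.get_eq_getElem, List.getElem_of_eq h1]
  rcases h.2.2 with ⟨hl, e⟩ | ⟨hl, x, hx, hxl, e⟩
  · obtain rfl : u.1 = a := by grind
    simp [e]
  · obtain rfl : u.1 = b := by grind
    obtain rfl : x = a := by grind
    simp [e]

theorem Descends.orientation {u v : π.UAtom} (h : π.Descends u v) :
    orientation v = orientation u := by
  induction h with
  | refl => rfl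
  | tail _ h ih => exact h.orientation.trans ih

theorem Descends.samePath {u v : π.UAtom} (h : π.Descends u v) : π.SamePath u v := by
  induction h with
  | refl => exact .refl _
  | tail _ h ih => exact .trans _ _ _ ih (.rel _ _ (.inr (.inr h)))

theorem SamePath.iff_of_linkRel {S : π.UAtom → Prop} (hS : ∀ u v, π.LinkRel u v → (S u ↔ S v))
    {u v : π.UAtom} (h : π.SamePath u v) : S u ↔ S v := by
  induction h with
  | rel u v h => exact hS u v h
  | refl u => exact .rfl
  | symm u v _ ih => exact ih.symm
  | trans u v w _ _ ih ih' => exact ih.trans ih'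

end ProofStructure

/-! ### Every persistent path reaches a conclusion -/

theorem OpenGraph.close_tgt_of_some {𝒳 : Type*} {G : OpenGraph 𝒳} {e : G.E} {l : G.L}
    (h : G.tgt e = some l) : G.close.tgt e = .inl l := by
  unfold OpenGraph.close
  dsimp only
  split <;> simp_all

theorem OpenGraph.close_tgt_of_none {𝒳 : Type*} {G : OpenGraph 𝒳} {e : G.E}
    (h : G.tgt e = none) : G.close.tgt e = .inr ⟨e, h⟩ := by
  unfold OpenGraph.close
  dsimp only
  split <;> simp_all

namespace ProofStructure

variable {𝒳 : Type*} {π : ProofStructure 𝒳}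

open Classical in
/-- A set of atoms of a proof net which is a union of classes of `≈` is empty if it contains no
atom of the conclusions. -/
theorem IsProofNet.eq_empty (hπ : π.IsProofNet) {S : π.UAtom → Prop}
    (hS : ∀ u v, π.LinkRel u v → (S u ↔ S v))
    (hc : ∀ u : π.UAtom, π.kind (π.tgt u.1) = .concl → ¬ S u) (u : π.UAtom) : ¬ S u := by
  obtain ⟨Γ, d, f, g, hsrc, htgt, hkind, hlab, hleft⟩ := hπ
  set G := d.openGraph
  -- The indicator function of `S`, extended by `false` beyond the atoms of the formula.
  let T : π.E → ℕ → Bool := fun e i => decide (∃ h : i < (π.lab e).atoms.length, S ⟨e, ⟨i, h⟩⟩)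
  have T_eq : ∀ {u v : π.UAtom}, π.LinkRel u v → T u.1 u.2 = T v.1 v.2 := by
    intro u v h
    have := hS u v h
    simp only [T, Fin.is_lt, exists_true_left, Fin.eta, decide_eq_decide]
    exact this
  have hlab' (e : G.E) : π.lab (g e) = G.lab e := hlab e
  have kS (e : G.E) : π.kind (π.src (g e)) = G.kind (G.src e) := by
    rw [hsrc, hkind]
    rfl
  have sE {e e' : G.E} (h : G.src e = G.src e') : π.src (g e) = π.src (g e') := by
    rw [hsrc, hsrc]
    exact congrArg (fun l => f (.inl l)) h
  have tE {e : G.E} {l : G.L} (h : G.tgt e = some l) : π.tgt (g e) = f (.inl l) := by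
    rw [htgt]
    exact congrArg _ (OpenGraph.close_tgt_of_some h)
  have kl (l : G.L) : π.kind (f (.inl l)) = G.kind l := hkind _
  have sl (e : G.E) : π.src (g e) = f (.inl (G.src e)) := hsrc _
  have lft {e c : G.E} (hk : G.kind (G.src c) = .tensor ∨ G.kind (G.src c) = .par)
      (h : G.tgt e = some (G.src c)) : π.left (g e) ↔ G.left e := by
    refine hleft e ?_
    have : G.close.tgt e = .inl (G.src c) := OpenGraph.close_tgt_of_some h
    change G.close.kind (G.close.tgt e) = _ ∨ G.close.kind (G.close.tgt e) = _
    rw [this]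
    exact hk
  have closed : G.Closed fun e i => T (g e) i := by
    constructor
    · intro e e' i j h1 h2 h3 h4
      have hl := lab_of_ax ((kS e).trans h1) (sE h2) (g.injective.ne h3)
      have hlen : (π.lab (g e')).atoms.length = (π.lab (g e)).atoms.length := by
        rw [hl, Formula.atoms_length_neg]
      rw [← hlab'] at h4
      exact T_eq (u := ⟨g e, ⟨i, by omega⟩⟩) (v := ⟨g e', ⟨j, by omega⟩⟩)
        (.inl ⟨(kS e).trans h1, sE h2, g.injective.ne h3, h4⟩)
    · intro e e' l i j h1 h2 h3 h4 h5
      have hk : π.kind (π.tgt (g e)) = .cut := by rw [tE h1, kl, h3]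
      have ht := (tE h1).trans (tE h2).symm
      have hl := lab_of_cut hk ht (g.injective.ne h4)
      have hlen : (π.lab (g e')).atoms.length = (π.lab (g e)).atoms.length := by
        rw [hl, Formula.atoms_length_neg]
      rw [← hlab'] at h5
      exact T_eq (u := ⟨g e, ⟨i, by omega⟩⟩) (v := ⟨g e', ⟨j, by omega⟩⟩)
        (.inr (.inl ⟨hk, ht, g.injective.ne h4, h5⟩))
    · intro e c i h1 h2 h3 h4
      rw [← hlab'] at h4
      have hk := h1
      rw [← kl, ← tE h2] at hk
      have ht := (tE h2).trans (sl c).symm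
      -- The atom below is unique: its edge is the only conclusion of the link, and its index is
      -- read off from the side of the premise.
      obtain ⟨v, hv⟩ := exists_down (u := ⟨g e, ⟨i, h4⟩⟩) (by unfold IsBottom; grind)
      have hvc : g c = v.1 := eq_of_src_eq (ht ▸ hk) (ht.symm.trans hv.2.1)
      have hv2 : (v.2 : ℕ) = i := by
        rcases hv.2.2 with h | h
        · exact h.2
        · exact absurd ((lft h1 h2).2 h3) h.1
      exact (congrArg₂ T hvc hv2.symm).trans (T_eq (.inr (.inr hv))).symm
    · intro e a c i h1 h2 h3 h4 h5 h6
      rw [← hlab'] at h6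
      have hk := h1
      rw [← kl, ← tE h2] at hk
      have ht := (tE h2).trans (sl c).symm
      obtain ⟨v, hv⟩ := exists_down (u := ⟨g e, ⟨i, h6⟩⟩) (by unfold IsBottom; grind)
      have hvc : g c = v.1 := eq_of_src_eq (ht ▸ hk) (ht.symm.trans hv.2.1)
      have hv2 : (v.2 : ℕ) = (G.lab a).atoms.length + i := by
        rcases hv.2.2 with h | ⟨-, x, hx, hxl, h⟩
        · exact absurd ((lft h1 h2).1 h.1) h3
        · obtain ⟨a', b', c', -, -, hb', ht', -⟩ := binary_spec hk
          have ha := (lft h1 h4).2 h5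
          have hta := (tE h4).trans (tE h2).symm
          obtain rfl : x = g a := by
            have hx : π.tgt x = π.tgt (g e) := hx
            grind
          rw [h, hlab']
      exact (congrArg₂ T hvc hv2.symm).trans (T_eq (.inr (.inr hv))).symm
  intro hu
  -- Vanishing of all signs contradicts `S u`; sign `1` on a pending edge is impossible because that
  -- edge is a conclusion of `π`, where `S` is empty.
  rcases d.coherent _ closed with h | ⟨e, he, h⟩
  · have h1 := h (g.symm u.1)
    rw [Formula.coherence_eq_zero, ← hlab', g.apply_symm_apply] at h1
    have := h1 u.2 u.2.2
    simp [T] at this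
    exact this hu
  · have h0 : (G.lab e).coherence (fun i => T (g e) i) = 0 := by
      rw [Formula.coherence_eq_zero]
      intro i hi
      rw [← hlab'] at hi
      have hk : π.kind (π.tgt (g e)) = .concl := by
        rw [htgt, hkind]
        have : G.close.tgt e = _ := OpenGraph.close_tgt_of_none (d.hasOutputs.tgt_eq_none e he)
        exact congrArg G.close.kind this
      simp only [T, decide_eq_false_iff_not, not_exists]
      exact fun h' => hc ⟨g e, ⟨i, h'⟩⟩ hk
    rw [h0] at h
    exact absurd h (by decide)

/-- The union of all paths which miss the conclusion respects the links, hence is empty. -/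
theorem IsProofNet.exists_samePath (hπ : π.IsProofNet) {e : π.E} (he : π.IsSingleConclusion e)
    (u : π.UAtom) : ∃ j, π.SamePath u ⟨e, j⟩ := by
  by_contra h
  refine hπ.eq_empty (S := fun u => ¬ ∃ j, π.SamePath u ⟨e, j⟩) ?_ ?_ u h
  · intro u v huv
    refine not_congr (exists_congr fun j => ⟨fun h => ?_, fun h => ?_⟩)
    · exact .trans _ _ _ (.symm _ _ (.rel _ _ huv)) h
    · exact .trans _ _ _ (.rel _ _ huv) h
  · rintro ⟨e', i⟩ hk
    obtain rfl := (he e').1 hk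
    exact not_not.2 ⟨i, .refl _⟩

/-! ### The first return path -/

theorem top_eq {x : π.AxAtom} {v : π.UAtom} (h : π.Descends x.1 v) : π.top v = x :=
  Subtype.ext (top_unique (top_descends v) h (π.top v).2 x.2)

theorem samePath_top (v : π.UAtom) : π.SamePath (π.top v).1 v := (top_descends v).samePath

theorem samePath_bottom (x : π.AxAtom) : π.SamePath x.1 (π.bottom x.1).1 :=
  (descends_bottom x.1).samePath

theorem axPerm_apply (x : π.AxAtom) : π.axPerm x = π.axMate x := rfl

theorem cutPerm_apply (x : π.AxAtom) : π.cutPerm x = π.top (π.cutMate (π.bottom x.1)).1 := rfl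

theorem axPerm_axPerm (x : π.AxAtom) : π.axPerm (π.axPerm x) = x := axMate_involutive x

theorem cutPerm_cutPerm (x : π.AxAtom) : π.cutPerm (π.cutPerm x) = x := by
  simp only [cutPerm_apply, bottom_top, cutMate_involutive _, top_bottom]

theorem cutPerm_of_visible {x : π.AxAtom} (h : x ∈ π.visible) : π.cutPerm x = x := by
  rw [cutPerm_apply, cutMate_of_ne, top_bottom]
  rw [visible, Set.mem_ofPred_eq] at h
  simp [h]

theorem cutRel_of_notMem_visible {x : π.AxAtom} (h : x ∉ π.visible) :
    π.CutRel (π.bottom x.1).1 (π.cutMate (π.bottom x.1)).1 :=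
  cutRel_cutMate ((π.bottom x.1).2.resolve_right h)

theorem samePath_axPerm (x : π.AxAtom) : π.SamePath x.1 (π.axPerm x).1 :=
  .rel _ _ (.inl (axRel_axMate x))

theorem samePath_cutPerm (x : π.AxAtom) : π.SamePath x.1 (π.cutPerm x).1 := by
  by_cases h : x ∈ π.visible
  · rw [cutPerm_of_visible h]
    exact .refl _
  · rw [cutPerm_apply]
    exact .trans _ _ _ (samePath_bottom x) (.trans _ _ _
      (.rel _ _ (.inr (.inl (cutRel_of_notMem_visible h)))) (.symm _ _ (samePath_top _)))

theorem orientation_axPerm (x : π.AxAtom) : orientation (π.axPerm x).1 = !orientation x.1 :=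
  (axRel_axMate x).orientation

theorem orientation_cutPerm {x : π.AxAtom} (h : x ∉ π.visible) :
    orientation (π.cutPerm x).1 = !orientation x.1 := by
  rw [cutPerm_apply, ← (descends_bottom x.1).orientation,
    ← (cutRel_of_notMem_visible h).orientation]
  exact (top_descends _).orientation.symm

/-- A set of atoms on conclusions of axiom links which is stable under `α` and `γ` contains with
`u` everything on the same persistent path. -/
theorem SamePath.top_mem_iff {T : Set π.AxAtom} (hα : ∀ x ∈ T, π.axPerm x ∈ T)
    (hγ : ∀ x ∈ T, π.cutPerm x ∈ T) {u v : π.UAtom} (h : π.SamePath u v) :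
    π.top u ∈ T ↔ π.top v ∈ T := by
  have hα' : ∀ x, x ∈ T ↔ π.axPerm x ∈ T := fun x =>
    ⟨hα x, fun h => by simpa only [axPerm_axPerm] using hα _ h⟩
  have hγ' : ∀ x, x ∈ T ↔ π.cutPerm x ∈ T := fun x =>
    ⟨hγ x, fun h => by simpa only [cutPerm_cutPerm] using hγ _ h⟩
  refine SamePath.iff_of_linkRel (S := fun u => π.top u ∈ T) ?_ h
  rintro u v (h | h | h)
  · have h1 : π.top u = ⟨u, h.1⟩ := top_eq .refl
    have h2 : π.top v = π.axPerm (π.top u) := by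
      have h2 : (π.axMate ⟨u, h.1⟩).1 = v :=
        (existsUnique_axRel h.1).unique (axRel_axMate ⟨u, h.1⟩) h
      rw [h1, axPerm_apply]
      exact top_eq (x := π.axMate ⟨u, h.1⟩) (by rw [h2]; exact .refl)
    rw [h2]
    exact hα' _
  · have h1 : π.bottom (π.top u).1 = ⟨u, .inl h.1⟩ := bottom_top ⟨u, .inl h.1⟩
    have h2 : π.top v = π.cutPerm (π.top u) := by
      have h2 : (π.cutMate ⟨u, .inl h.1⟩).1 = v :=
        (existsUnique_cutRel h.1).unique (cutRel_cutMate (u := ⟨u, .inl h.1⟩) h.1) h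
      rw [cutPerm_apply, h1, h2]
    rw [h2]
    exact hγ' _
  · rw [top_eq (v := v) (.tail (top_descends u) h)]

theorem goiPerm_apply (x : π.AxAtom) :
    π.goiPerm x = firstReturnFun (π.axPerm * π.cutPerm) π.visible x := rfl

theorem goiPerm_mem_visible {x : π.AxAtom} (hx : x ∈ π.visible) : π.goiPerm x ∈ π.visible :=
  firstReturnFun_mem _ hx

theorem samePath_goiPerm (x : π.AxAtom) : π.SamePath x.1 (π.goiPerm x).1 := by
  by_cases hx : x ∈ π.visible
  · obtain ⟨n, -, hn, -⟩ := exists_firstReturnFun (π.axPerm * π.cutPerm) hx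
    rw [goiPerm_apply, hn]
    clear hn
    induction n with
    | zero => exact .refl _
    | succ n ih =>
      rw [pow_succ', Equiv.Perm.mul_apply, Equiv.Perm.mul_apply]
      exact .trans _ _ _ ih (.trans _ _ _ (samePath_cutPerm _) (samePath_axPerm _))
  · rw [goiPerm_apply, firstReturnFun_of_notMem _ hx]
    exact .refl _

/-- The first `α * γ` flips the orientation once, because `γ` fixes the visible `x`; each further
one flips it twice, since the points before the first return are not visible. -/
theorem orientation_goiPerm {x : π.AxAtom} (hx : x ∈ π.visible) :
    orientation (π.goiPerm x).1 = !orientation x.1 := by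
  obtain ⟨n, h0, hn, hmin⟩ := exists_firstReturnFun (π.axPerm * π.cutPerm) hx
  rw [goiPerm_apply, hn]
  suffices h : ∀ m, m + 1 ≤ n →
      orientation (((π.axPerm * π.cutPerm) ^ (m + 1)) x).1 = !orientation x.1 by
    obtain ⟨m, rfl⟩ := Nat.exists_eq_add_one_of_ne_zero h0.ne'
    exact h m le_rfl
  intro m hm
  induction m with
  | zero =>
    rw [zero_add, pow_one, Equiv.Perm.mul_apply, cutPerm_of_visible hx, orientation_axPerm]
  | succ m ih =>
    rw [pow_succ', Equiv.Perm.mul_apply, Equiv.Perm.mul_apply, orientation_axPerm,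
      orientation_cutPerm fun h => absurd (hmin _ (by omega) h) (by omega), ih (by omega),
      Bool.not_not]

/-- The only atoms of the conclusions on the persistent path of `x` are its two ends `x` and
`δ x`. -/
theorem eq_or_eq_goiPerm {x y : π.AxAtom} (hx : x ∈ π.visible) (hy : y ∈ π.visible)
    (h : π.SamePath x.1 y.1) : y = x ∨ y = π.goiPerm x := by
  obtain ⟨n, h0, hn, hmin⟩ := exists_firstReturnFun (π.axPerm * π.cutPerm) hx
  have hv := goiPerm_mem_visible hx
  rw [goiPerm_apply, hn] at *
  set f := π.axPerm * π.cutPerm with hf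
  have hsucc : ∀ k, π.axPerm (π.cutPerm ((f ^ k) x)) = (f ^ (k + 1)) x := by
    intro k
    rw [pow_succ', Equiv.Perm.mul_apply f, hf, Equiv.Perm.mul_apply]
  have hax : ∀ k, π.axPerm ((f ^ (k + 1)) x) = π.cutPerm ((f ^ k) x) := by
    intro k
    rw [← hsucc, axPerm_axPerm]
  -- All atoms met on the way from `x` to its first return. Here `α` links `γ (f ^ k x)` to `f ^ (k
  -- + 1) x`, and at both ends `γ` is the identity, so nothing leads out of `T`.
  let T : Set π.AxAtom := {z | ∃ k ≤ n, z = (f ^ k) x ∨ z = π.cutPerm ((f ^ k) x)}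
  have hT : π.top x.1 ∈ T ↔ π.top y.1 ∈ T := by
    refine SamePath.top_mem_iff ?_ ?_ h
    · rintro _ ⟨k, hk, rfl | rfl⟩
      · rcases k with _ | k
        · refine ⟨1, h0, .inl ?_⟩
          rw [← hsucc 0, pow_zero, Equiv.Perm.one_apply, cutPerm_of_visible hx]
        · exact ⟨k, by omega, .inr (hax k)⟩
      · rcases hk.lt_or_eq with hk | rfl
        · exact ⟨k + 1, hk, .inl (hsucc k)⟩
        · obtain ⟨m, rfl⟩ := Nat.exists_eq_add_one_of_ne_zero h0.ne'
          rw [cutPerm_of_visible hv]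
          exact ⟨m, by omega, .inr (hax m)⟩
    · rintro _ ⟨k, hk, rfl | rfl⟩
      · exact ⟨k, hk, .inr rfl⟩
      · exact ⟨k, hk, .inl (cutPerm_cutPerm _)⟩
  have hxx : π.top x.1 = x := top_eq .refl
  have hyy : π.top y.1 = y := top_eq .refl
  rw [hxx, hyy] at hT
  obtain ⟨k, hk, hyk⟩ := hT.1 ⟨0, h0.le, .inl rfl⟩
  -- If `y` is the `γ`-image of a point of the orbit, it equals that point, as `γ` is an involution
  -- fixing the visible `y`.
  have hyk : y = (f ^ k) x := by
    rcases hyk with hyk | hyk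
    · exact hyk
    · rw [← cutPerm_of_visible hy, hyk, cutPerm_cutPerm]
  rcases Nat.eq_zero_or_pos k with rfl | hk0
  · exact .inl hyk
  · have := hmin k hk0 (hyk ▸ hy)
    obtain rfl : k = n := by omega
    exact .inr hyk

/-! ### The coordinate ring -/

theorem SamePath.mk_X_eq (k : Type*) [Field k] {u v : π.UAtom} (h : π.SamePath u v) :
    Ideal.Quotient.mkₐ k (π.definingIdeal k) (MvPolynomial.X u) =
      Ideal.Quotient.mkₐ k (π.definingIdeal k) (MvPolynomial.X v) := by
  induction h with
  | rel u v h => exact Ideal.Quotient.eq.2 (Ideal.subset_span ⟨u, v, h, rfl⟩)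
  | refl u => rfl
  | symm u v _ ih => exact ih.symm
  | trans u v w _ _ ih ih' => exact ih.trans ih'

theorem toCoordinateRing_X (k : Type*) [Field k] {m : ℕ} (x : Fin m → π.UAtom) (i : Fin m) :
    π.toCoordinateRing k x (MvPolynomial.X i) =
      Ideal.Quotient.mkₐ k (π.definingIdeal k) (MvPolynomial.X (x i)) := by
  simp [toCoordinateRing]

/-- If every persistent path contains exactly one of the atoms `x₁, …, x_m`, then these are free
generators of the coordinate ring. -/
theorem bijective_toCoordinateRing (k : Type*) [Field k] {m : ℕ} {x : Fin m → π.UAtom}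
    (h : ∀ u, ∃! i, π.SamePath u (x i)) : Function.Bijective (π.toCoordinateRing k x) := by
  choose r hr hr' using h
  have hlink : ∀ u v, π.LinkRel u v → r u = r v := fun u v huv =>
    hr' v (r u) (.trans _ _ _ (.symm _ _ (.rel _ _ huv)) (hr u))
  have hrx : ∀ i, r (x i) = i := fun i => (hr' (x i) i (.refl _)).symm
  constructor
  -- The left inverse sends each atom to the representative of its path; this respects the relations
  -- because `r` is constant across links.
  · let g : π.CoordinateRing k →ₐ[k] MvPolynomial (Fin m) k :=
      Ideal.Quotient.liftₐ (π.definingIdeal k) (MvPolynomial.rename r) (by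
        intro a ha
        have hle : π.definingIdeal k ≤ RingHom.ker (MvPolynomial.rename (R := k) r) := by
          refine Ideal.span_le.2 ?_
          rintro _ ⟨u, v, huv, rfl⟩
          simp [RingHom.mem_ker, hlink u v huv]
        exact hle ha)
    have hg : ∀ p, g (π.toCoordinateRing k x p) = p := by
      intro p
      change MvPolynomial.rename r (MvPolynomial.rename x p) = p
      rw [MvPolynomial.rename_rename, show r ∘ x = id from funext hrx, MvPolynomial.rename_id_apply]
    exact Function.LeftInverse.injective hg
  · intro q
    obtain ⟨p, rfl⟩ := Ideal.Quotient.mk_surjective q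
    refine ⟨MvPolynomial.rename r p, ?_⟩
    -- In the quotient each variable equals that of its representative, so every class lifts to a
    -- polynomial in the representatives.
    have : ((π.toCoordinateRing k x).comp (MvPolynomial.rename r)) =
        Ideal.Quotient.mkₐ k (π.definingIdeal k) := by
      refine MvPolynomial.algHom_ext fun u => ?_
      rw [AlgHom.comp_apply, MvPolynomial.rename_X, toCoordinateRing_X]
      exact (SamePath.mk_X_eq k (hr u)).symm
    exact DFunLike.congr_fun this p

end ProofStructure

/-! ### Assembly on the positions of the conclusion -/

theorem Formula.exists_posIndex {𝒳 : Type*} (A : Formula 𝒳) {m : ℕ} (h : A.posIndices.card = m)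
    (j : Fin A.atoms.length) : (∃ i, A.posIndex h i = j) ↔ (A.atoms.get j).2 = true := by
  refine (Set.ext_iff.1 (Finset.range_orderEmbOfFin A.posIndices h) j).trans ?_
  simp [posIndices]

theorem Formula.exists_negIndex {𝒳 : Type*} (A : Formula 𝒳) {m : ℕ} (h : A.negIndices.card = m)
    (j : Fin A.atoms.length) : (∃ i, A.negIndex h i = j) ↔ (A.atoms.get j).2 = false := by
  refine (Set.ext_iff.1 (Finset.range_orderEmbOfFin A.negIndices h) j).trans ?_
  simp [negIndices]

theorem mainTheorem11 {𝒳 : Type*} (k : Type*) [Field k] (π : ProofStructure 𝒳)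
    (hπ : π.IsProofNet) (e : π.E) (he : π.IsSingleConclusion e) :
    ∃ (m : ℕ) (hp : (π.lab e).posIndices.card = m) (hn : (π.lab e).negIndices.card = m)
      (_ : Function.Bijective (π.toCoordinateRing k (π.posAtom e hp)))
      (hb : Function.Bijective (π.toCoordinateRing k (π.negAtom e hn)))
      (σ : Equiv.Perm (Fin m)) (τ : Equiv.Perm (Fin (π.lab e).atoms.length)),
      -- `β₋⁻¹ (β₊ U_i) = V_{σ i}`
      (∀ i : Fin m, (AlgEquiv.ofBijective _ hb).symm
        (π.toCoordinateRing k (π.posAtom e hp) (MvPolynomial.X i)) = MvPolynomial.X (σ i)) ∧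
      -- `V_{σ i}` and `U_i` are on the same persistent path
      (∀ i : Fin m, π.SamePath (π.negAtom e hn (σ i)) (π.posAtom e hp i)) ∧
      -- `τ` is `σ` as a permutation of all atoms of the conclusion: it swaps `U_i` and `V_{σ i}`
      (∀ i : Fin m,
        τ ((π.lab e).posIndex hp i) = (π.lab e).negIndex hn (σ i) ∧
        τ ((π.lab e).negIndex hn (σ i)) = (π.lab e).posIndex hp i) ∧
      -- `δ_π` agrees with this permutation
      (∀ j : Fin (π.lab e).atoms.length,
        π.goiPerm (π.top ⟨e, j⟩) = π.top ⟨e, τ j⟩) := by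
  open ProofStructure in
  have hke : π.kind (π.tgt e) = .concl := (he e).2 rfl
  let Z : Fin (π.lab e).atoms.length → π.UAtom := fun j => ⟨e, j⟩
  have hbot (j) : π.bottom (π.top (Z j)).1 = ⟨Z j, .inr hke⟩ := bottom_top ⟨Z j, .inr hke⟩
  have hvis (j) : π.top (Z j) ∈ π.visible := by
    rw [visible, Set.mem_ofPred_eq, hbot]
    exact hke
  have htop_inj (i j) (h : π.top (Z i) = π.top (Z j)) : i = j := by
    have := (hbot i).symm.trans ((congrArg (fun x => π.bottom x.1) h).trans (hbot j))
    exact eq_of_heq (Sigma.mk.inj (congrArg Subtype.val this)).2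
  have hex (x : π.AxAtom) (hx : x ∈ π.visible) : ∃ j, π.top (Z j) = x := by
    obtain ⟨⟨⟨e', j⟩, h⟩, hb⟩ : ∃ v, π.bottom x.1 = v := ⟨_, rfl⟩
    have h1 : π.kind (π.tgt (π.bottom x.1).1.1) = .concl := hx
    rw [hb] at h1
    obtain rfl := (he e').1 h1
    exact ⟨j, by rw [← top_bottom x, hb]⟩
  -- The map `t` is `δ` read on positions; it serves as the permutation `τ`.
  choose t ht using fun j => hex _ (goiPerm_mem_visible (hvis j))
  have ht_path (j) : π.SamePath (Z j) (Z (t j)) := by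
    refine .trans _ _ _ (.symm _ _ (samePath_top _)) (.trans _ _ _ (samePath_goiPerm _) ?_)
    rw [← ht]
    exact samePath_top _
  have ht_sign (j) : ((π.lab e).atoms.get (t j)).2 = !((π.lab e).atoms.get j).2 := by
    have := orientation_goiPerm (hvis j)
    rw [← ht, ← (top_descends _).orientation, ← (top_descends _).orientation] at this
    exact this
  have ht_eq {i j} (h : π.SamePath (Z i) (Z j)) : j = i ∨ j = t i := by
    refine (eq_or_eq_goiPerm (hvis i) (hvis j) (.trans _ _ _ (samePath_top _)
      (.trans _ _ _ h (.symm _ _ (samePath_top _))))).imp (htop_inj _ _) fun h => ?_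
    rw [← ht] at h
    exact htop_inj _ _ h
  have ht_inv (j) : t (t j) = j := by
    -- The position `t (t j)` lies on the path of `j`, hence is `j` or `t j`; the latter contradicts
    -- the reversal of signs.
    refine (ht_eq (.trans _ _ _ (ht_path j) (ht_path (t j)))).resolve_right fun h => ?_
    have := ht_sign (t j)
    rw [h] at this
    simp at this
  have hcard : (π.lab e).negIndices.card = (π.lab e).posIndices.card := by
    refine Finset.card_bij' (fun j _ => t j) (fun j _ => t j) ?_ ?_ (fun j _ => ht_inv j)
      fun j _ => ht_inv j
    · intro j hj
      simp only [Formula.negIndices, Formula.posIndices, Finset.mem_filter] at hj ⊢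
      exact ⟨Finset.mem_univ _, by rw [ht_sign, hj.2]; rfl⟩
    · intro j hj
      simp only [Formula.negIndices, Formula.posIndices, Finset.mem_filter] at hj ⊢
      exact ⟨Finset.mem_univ _, by rw [ht_sign, hj.2]; rfl⟩
  -- Used for both signs. Every path meets the conclusion in some pair `j`, `t j` of opposite signs,
  -- exactly one of which has sign `b`.
  have reps {m : ℕ} (b : Bool) (p : Fin m → Fin (π.lab e).atoms.length)
      (hinj : Function.Injective p)
      (hp : ∀ j, (∃ i, p i = j) ↔ ((π.lab e).atoms.get j).2 = b) (u : π.UAtom) :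
      ∃! i, π.SamePath u (Z (p i)) := by
    obtain ⟨j, hj⟩ := hπ.exists_samePath he u
    have : ∃ i, π.SamePath u (Z (p i)) := by
      by_cases h : ((π.lab e).atoms.get j).2 = b
      · obtain ⟨i, rfl⟩ := (hp j).2 h
        exact ⟨i, hj⟩
      · obtain ⟨i, hi⟩ := (hp (t j)).2 (by rw [ht_sign]; revert h; cases b <;> simp)
        exact ⟨i, hi ▸ .trans _ _ _ hj (ht_path j)⟩
    obtain ⟨i, hi⟩ := this
    refine ⟨i, hi, fun i' hi' => hinj ?_⟩
    refine (ht_eq (.trans _ _ _ (.symm _ _ hi) hi')).resolve_right fun h => ?_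
    have h1 := ht_sign (p i)
    rw [← h, (hp _).1 ⟨i, rfl⟩, (hp _).1 ⟨i', rfl⟩] at h1
    simp at h1
  have hσ (i) : ∃ i', (π.lab e).negIndex hcard i' = t ((π.lab e).posIndex rfl i) := by
    rw [Formula.exists_negIndex, ht_sign, ((π.lab e).exists_posIndex rfl _).1 ⟨i, rfl⟩]
    rfl
  choose s hs using hσ
  have hs_inj : Function.Injective s := by
    intro i i' h
    have h1 := (hs i).symm.trans ((congrArg _ h).trans (hs i'))
    have h2 := congrArg t h1
    rw [ht_inv, ht_inv] at h2
    exact ((π.lab e).posIndices.orderEmbOfFin rfl).injective h2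
  have hpath (i) : π.SamePath (π.negAtom e hcard (s i)) (π.posAtom e rfl i) := by
    unfold negAtom
    rw [hs]
    exact .symm _ _ (ht_path _)
  have hbn : Function.Bijective (π.toCoordinateRing k (π.negAtom e hcard)) :=
    bijective_toCoordinateRing k (reps false _
      ((π.lab e).negIndices.orderEmbOfFin hcard).injective ((π.lab e).exists_negIndex hcard))
  -- Here `m` is the number of positive atoms by definition, and `hcard` transfers it to the
  -- negative ones.
  refine ⟨_, rfl, hcard, bijective_toCoordinateRing k (reps true _
      ((π.lab e).posIndices.orderEmbOfFin rfl).injective ((π.lab e).exists_posIndex rfl)), hbn,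
    .ofBijective s (Finite.injective_iff_bijective.1 hs_inj),
    (Function.Involutive.toPerm t ht_inv), fun i => ?_, hpath, fun i => ⟨?_, ?_⟩, fun j => ?_⟩
  · rw [AlgEquiv.symm_apply_eq, AlgEquiv.coe_ofBijective, toCoordinateRing_X, toCoordinateRing_X]
    exact (SamePath.mk_X_eq k (hpath i)).symm
  · exact (hs i).symm
  · change t ((π.lab e).negIndex hcard (s i)) = _
    rw [hs, ht_inv]
  · exact (ht j).symm
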